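/- Let $E,A\in\mathbb C^{n\times n}$ with $E=E^H\ge 0$ and $A=J-R$, where $J=\tfrac12(A-A^H)$ and $R=-\tfrac12(A+A^H)\ge 0$ (so $E\dot x=Ax$, $t\ge0$, is a semi-dissipative Hamiltonian DAE). **Definitions.** The HC-index of a semi-dissipative matrix $B=J_B-R_B$ (with $J_B=\tfrac12(B-B^H)$, $R_B=-\tfrac12(B+B^H)$) is the smallest $m\in\mathbb N_0$ with $\sum_{j=0}^m J_B^{\,j}R_B(J_B^H)^j>0$, and $\infty$ if there is no such $m$. The pencil $\lambda E-A$ is regular if $\det(\lambda_0E-A)\ne0$ for some $\lambda_0\in\mathbb C$. Its DAE-index is the size of the largest block $\lambda\mathcal J_\sigma(0)-I_\sigma$ in its Kronecker canonical form ($0$ if $E$ is invertible). The pencil is negative hypocoercive if it is regular, has DAE-index at most two, and all its finite eigenvalues (the zeros of $\det(\lambda E-A)$) have negative real part. A staircase form of $(E,J,R)$ is given by a unitary $P$ and a partition into $5\times5$ blocks, with square diagonal blocks of sizes $n_1,n_2,n_3,n_4=n_1,n_5\in\mathbb N_0$, such that $$PEP^H=\begin{bmatrix}E_{11}&E_{21}^H&0&0&0\\E_{21}&E_{22}&0&0&0\\0&0&0&0&0\\0&0&0&0&0\\0&0&0&0&0\end{bmatrix},\quad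 PJP^H=\begin{bmatrix}J_{11}&-J_{21}^H&-J_{31}^H&-J_{41}^H&0\\J_{21}&J_{22}&-J_{32}^H&0&0\\J_{31}&J_{32}&J_{33}&0&0\\J_{41}&0&0&0&0\\0&0&0&0&0\end{bmatrix},\quad PRP^H=\begin{bmatrix}R_{11}&R_{21}^H&R_{31}^H&0&0\\R_{21}&R_{22}&R_{32}^H&0&0\\R_{31}&R_{32}&R_{33}&0&0\\0&0&0&0&0\\0&0&0&0&0\end{bmatrix},$$ where $\begin{bmatrix}E_{11}&E_{21}^H\\E_{21}&E_{22}\end{bmatrix}$ is positive definite and $J_{41}$ and $J_{33}-R_{33}$ are invertible (blocks of size $0$ being absent). Write $A_{ij}$ for the blocks of $PAP^H$ and $\widehat A_{22}=A_{22}-A_{23}A_{33}^{-1}A_{32}$ ($\widehat A_{22}=A_{22}$ if $n_3=0$). The DAE has non-trivial dynamics if the underlying ODE $E_{22}\dot y_2=\widehat A_{22}y_2$ is present, i.e. $n_2>0$. The HC-index $m_{HC}$ of $\lambda E-A$ is then the HC-index of $(E_{22}^{1/2})^{-1}\widehat A_{22}(E_{22}^{1/2})^{-1}$. An initial value $x(0)$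 is consistent if $E\dot x=Ax$ has a continuously differentiable solution $x$ on $[0,\infty)$ with this initial value. With $\|v\|_E=\sqrt{v^HEv}$, the propagator (semi-)norm is $$\|S(t)\|_E:=\sup\{\|x(t)\|_E:\ x\text{ a solution with consistent }x(0),\ \|x(0)\|_E=1\},\qquad t\ge0.$$ **Proposition.** Suppose that the pencil $\lambda E-A$ is negative hypocoercive (in particular regular and of DAE-index at most two), and that the DAE $E\dot x=Ax$ has non-trivial dynamics. Then for every $t\ge0$ the supremum defining $\|S(t)\|_E$ is taken over a non-empty set that is bounded above. A staircase form of $(E,J,R)$ exists, and the HC-index of $\lambda E-A$ does not depend on its choice and is finite. Moreover, for every $m\in\mathbb N_0$, the HC-index of $\lambda E-A$ equals $m$ if and only if there is a constant $c>0$ such that, with $a=2m+1$, $$\|S(t)\|_E=1-c\,t^{a}+\mathcal O(t^{a+1})\qquad\text{as }t\to0+.$$ -/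

import Mathlib

open Matrix Filter Topology Set
open scoped MatrixOrder ComplexOrder

namespace HCDAE

noncomputable section

/-- The Hermitian part `A_H = (A + Aᴴ) / 2` of a complex square matrix. -/
def hermPart {ι : Type} (A : Matrix ι ι ℂ) : Matrix ι ι ℂ := (1 / 2 : ℂ) • (A + Aᴴ)

/-- The skew-Hermitian part `A_S = (A - Aᴴ) / 2` of a complex square matrix; this is the matrix `J`
in the decomposition `A = J - R`. -/
def skewPart {ι : Type} (A : Matrix ι ι ℂ) : Matrix ι ι ℂ := (1 / 2 : ℂ) • (A - Aᴴ)

/-- The matrix `R = -A_H` in the decomposition `A = J - R`. -/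
def dissPart {ι : Type} (A : Matrix ι ι ℂ) : Matrix ι ι ℂ := -hermPart A

/-- `A` is semi-dissipative: its Hermitian part is negative semi-definite. -/
def IsSemiDissipative {ι : Type} (A : Matrix ι ι ℂ) : Prop := (dissPart A).PosSemidef

/-- `T_m = ∑_{j=0}^m J^j R (Jᴴ)^j`, where `A = J - R`. -/
def kalmanSum {ι : Type} [Fintype ι] [DecidableEq ι] (A : Matrix ι ι ℂ) (m : ℕ) : Matrix ι ι ℂ :=
  ∑ j ∈ Finset.range (m + 1), skewPart A ^ j * dissPart A * (skewPart A)ᴴ ^ j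

/-- The hypocoercivity index of a (semi-dissipative) matrix `A = J - R`: the smallest `m : ℕ` such
that `T_m` is positive definite, and `∞` if there is none. -/
def hcIndex {ι : Type} [Fintype ι] [DecidableEq ι] (A : Matrix ι ι ℂ) : ℕ∞ :=
  ⨅ (m : ℕ) (_ : (kalmanSum A m).PosDef), (m : ℕ∞)

/-! ### Matrix pencils `λ E - A` -/

/-- The pencil `λ E - A` is regular. -/
def IsRegularPencil {n : ℕ} (E A : Matrix (Fin n) (Fin n) ℂ) : Prop :=
  ∃ l : ℂ, (l • E - A).det ≠ 0

/-- `l` is a finite eigenvalue of the (regular) pencil `λ E - A`. -/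
def IsFiniteEigenvalue {n : ℕ} (E A : Matrix (Fin n) (Fin n) ℂ) (l : ℂ) : Prop :=
  (l • E - A).det = 0

/-- The upper triangular Jordan block of size `k` with eigenvalue `l`. -/
def jordanBlock (k : ℕ) (l : ℂ) : Matrix (Fin k) (Fin k) ℂ :=
  Matrix.of fun i j => if j = i then l else if (j : ℕ) = i + 1 then 1 else 0

/-- The Kronecker canonical form of a regular pencil `λ E - A`: nonsingular `S`, `T` such that
`S (λ E - A) T` is block diagonal, with blocks `λ I - 𝒥_{ρ i}(ev i)` and `λ 𝒥_{σ j}(0) - I`. -/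
structure KroneckerForm {n : ℕ} (E A : Matrix (Fin n) (Fin n) ℂ) where
  r : ℕ
  s : ℕ
  ρ : Fin r → ℕ
  ev : Fin r → ℂ
  σ : Fin s → ℕ
  ρ_pos : ∀ i, 0 < ρ i
  σ_pos : ∀ j, 0 < σ j
  e : ((i : Fin r) × Fin (ρ i)) ⊕ ((j : Fin s) × Fin (σ j)) ≃ Fin n
  S : Matrix (Fin n) (Fin n) ℂ
  T : Matrix (Fin n) (Fin n) ℂ
  isUnit_S : IsUnit S
  isUnit_T : IsUnit T
  mul_E : S * E * T = Matrix.reindex e e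
    (Matrix.fromBlocks 1 0 0 (Matrix.blockDiagonal' fun j => jordanBlock (σ j) 0))
  mul_A : S * A * T = Matrix.reindex e e
    (Matrix.fromBlocks (Matrix.blockDiagonal' fun i => jordanBlock (ρ i) (ev i)) 0 0 1)

/-- The DAE-index (Kronecker index) of a regular pencil: the size of the largest block
`λ 𝒥_{σ j}(0) - I` in the Kronecker canonical form, and `0` if there is no such block (that is, if
`E` is invertible). The canonical form of a regular pencil exists and is unique up to permutation
of the blocks, so the infimum is over a one-element set. -/
def daeIndex {n : ℕ} (E A : Matrix (Fin n) (Fin n) ℂ) : ℕ :=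
  sInf {ν | ∃ K : KroneckerForm E A, ν = Finset.univ.sup K.σ}

/-- The pencil `λ E - A` is negative hypocoercive: it is regular, of DAE-index at most two, and all
its finite eigenvalues have negative real part. -/
structure IsNegativeHypocoercive {n : ℕ} (E A : Matrix (Fin n) (Fin n) ℂ) : Prop where
  regular : IsRegularPencil E A
  index_le_two : daeIndex E A ≤ 2
  re_neg : ∀ l : ℂ, IsFiniteEigenvalue E A l → l.re < 0

/-! ### The staircase form -/

/-- Row and column indices of a `5 × 5` block matrix with square diagonal blocks of sizes
`n₁, n₂, n₃, n₄ = n₁, n₅`. -/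
abbrev StairIdx (n₁ n₂ n₃ n₅ : ℕ) : Type :=
  Fin n₁ ⊕ Fin n₂ ⊕ Fin n₃ ⊕ Fin n₁ ⊕ Fin n₅

namespace StairIdx

variable {n₁ n₂ n₃ n₅ : ℕ}

/-- The indices of the first block. -/
def in₁ (i : Fin n₁) : StairIdx n₁ n₂ n₃ n₅ := Sum.inl i
/-- The indices of the second block. -/
def in₂ (i : Fin n₂) : StairIdx n₁ n₂ n₃ n₅ := Sum.inr (Sum.inl i)
/-- The indices of the third block. -/
def in₃ (i : Fin n₃) : StairIdx n₁ n₂ n₃ n₅ := Sum.inr (Sum.inr (Sum.inl i))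
/-- The indices of the fourth block. -/
def in₄ (i : Fin n₁) : StairIdx n₁ n₂ n₃ n₅ := Sum.inr (Sum.inr (Sum.inr (Sum.inl i)))
/-- The indices of the fifth block. -/
def in₅ (i : Fin n₅) : StairIdx n₁ n₂ n₃ n₅ := Sum.inr (Sum.inr (Sum.inr (Sum.inr i)))

end StairIdx

open StairIdx

/-- A staircase form of the triple `(E, J, R)`, `A = J - R`: a unitary matrix `P` (its rows are
labelled by the five blocks) such that, with the `5 × 5` block partition,

* `P E Pᴴ` vanishes outside its leading `2 × 2` blocks, which form a positive definite matrix;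
* `P J Pᴴ` has zero blocks `(4,2)`, `(4,3)`, `(4,4)` and a zero fifth block row;
* `P R Pᴴ` has zero fourth and fifth block rows;
* the block `J₄₁` and the block `A₃₃ = J₃₃ - R₃₃` are invertible.

The corresponding zero block columns follow, `E` and `R` being Hermitian and `J` skew-Hermitian.
Blocks of size `0` are allowed. -/
structure StaircaseForm {n : ℕ} (E A : Matrix (Fin n) (Fin n) ℂ) where
  n₁ : ℕ
  n₂ : ℕ
  n₃ : ℕ
  n₅ : ℕ
  P : Matrix (StairIdx n₁ n₂ n₃ n₅) (Fin n) ℂ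
  mul_conjTranspose : P * Pᴴ = 1
  conjTranspose_mul : Pᴴ * P = 1
  E_row₃ : ∀ i q, (P * E * Pᴴ) (in₃ i) q = 0
  E_row₄ : ∀ i q, (P * E * Pᴴ) (in₄ i) q = 0
  E_row₅ : ∀ i q, (P * E * Pᴴ) (in₅ i) q = 0
  E_posDef : ((P * E * Pᴴ).submatrix (Sum.elim in₁ in₂) (Sum.elim in₁ in₂)).PosDef
  J_block₄₂ : ∀ i j, (P * skewPart A * Pᴴ) (in₄ i) (in₂ j) = 0
  J_block₄₃ : ∀ i j, (P * skewPart A * Pᴴ) (in₄ i) (in₃ j) = 0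
  J_block₄₄ : ∀ i j, (P * skewPart A * Pᴴ) (in₄ i) (in₄ j) = 0
  J_row₅ : ∀ i q, (P * skewPart A * Pᴴ) (in₅ i) q = 0
  R_row₄ : ∀ i q, (P * dissPart A * Pᴴ) (in₄ i) q = 0
  R_row₅ : ∀ i q, (P * dissPart A * Pᴴ) (in₅ i) q = 0
  isUnit_J₄₁ : IsUnit ((P * skewPart A * Pᴴ).submatrix in₄ in₁)
  isUnit_A₃₃ : IsUnit ((P * A * Pᴴ).submatrix in₃ in₃)

namespace StaircaseForm

variable {n : ℕ} {E A : Matrix (Fin n) (Fin n) ℂ}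

/-- The matrix `E₂₂` of the underlying implicit ODE `E₂₂ y₂' = Â₂₂ y₂`. -/
def E₂₂ (F : StaircaseForm E A) : Matrix (Fin F.n₂) (Fin F.n₂) ℂ :=
  (F.P * E * F.Pᴴ).submatrix in₂ in₂

/-- The matrix `Â₂₂ = A₂₂ - A₂₃ A₃₃⁻¹ A₃₂` of the underlying implicit ODE
(it is `A₂₂` if the third block is absent). -/
def Ahat₂₂ (F : StaircaseForm E A) : Matrix (Fin F.n₂) (Fin F.n₂) ℂ :=
  (F.P * A * F.Pᴴ).submatrix in₂ in₂ - (F.P * A * F.Pᴴ).submatrix in₂ in₃ *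
    ((F.P * A * F.Pᴴ).submatrix in₃ in₃)⁻¹ * (F.P * A * F.Pᴴ).submatrix in₃ in₂

/-- The system matrix `(E₂₂^{1/2})⁻¹ Â₂₂ (E₂₂^{1/2})⁻¹` of the underlying ODE. -/
def systemMatrix (F : StaircaseForm E A) : Matrix (Fin F.n₂) (Fin F.n₂) ℂ :=
  (CFC.sqrt F.E₂₂)⁻¹ * F.Ahat₂₂ * (CFC.sqrt F.E₂₂)⁻¹

end StaircaseForm

/-- `E x' = A x` exhibits non-trivial dynamics: no staircase form lacks the underlying implicit ODE
(the block sizes do not depend on the choice of the staircase form). -/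
def HasNontrivialDynamics {n : ℕ} (E A : Matrix (Fin n) (Fin n) ℂ) : Prop :=
  ∀ F : StaircaseForm E A, 0 < F.n₂

/-- The HC-index of the pencil `λ E - A` is well defined and equal to `m`: staircase forms exist,
and for each of them the system matrix of the underlying ODE has HC-index `m`. (If the underlying
ODE is missing, the system matrix is the `0 × 0` matrix, of HC-index `0`.) -/
def HasHCIndex {n : ℕ} (E A : Matrix (Fin n) (Fin n) ℂ) (m : ℕ∞) : Prop :=
  Nonempty (StaircaseForm E A) ∧ ∀ F : StaircaseForm E A, hcIndex F.systemMatrix = m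

/-! ### Solutions and the propagator seminorm -/

/-- `x` is a (classical) solution of `E x'(t) = A x(t)` for `t ≥ 0`. -/
structure IsSolution {n : ℕ} (E A : Matrix (Fin n) (Fin n) ℂ) (x : ℝ → Fin n → ℂ) : Prop where
  contDiffOn : ContDiffOn ℝ 1 x (Ici 0)
  eq : ∀ t : ℝ, 0 ≤ t → E *ᵥ derivWithin x (Ici 0) t = A *ᵥ x t

/-- The seminorm `‖v‖_E = √(vᴴ E v)`. -/
def eSeminorm {n : ℕ} (E : Matrix (Fin n) (Fin n) ℂ) (v : Fin n → ℂ) : ℝ :=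
  √(star v ⬝ᵥ E *ᵥ v).re

/-- The values `‖x(t)‖_E`, where `x` is the solution for a consistent initial value `x(0)` (one for
which a solution exists) with `‖x(0)‖_E = 1`. -/
def propagatorValues {n : ℕ} (E A : Matrix (Fin n) (Fin n) ℂ) (t : ℝ) : Set ℝ :=
  {s | ∃ x : ℝ → Fin n → ℂ, IsSolution E A x ∧ eSeminorm E (x 0) = 1 ∧ s = eSeminorm E (x t)}

/-- The propagator seminorm `‖S(t)‖_E`: the supremum of `‖x(t)‖_E` over all consistent initial
values `x(0)` with `‖x(0)‖_E = 1`. -/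
def propagatorSeminorm {n : ℕ} (E A : Matrix (Fin n) (Fin n) ℂ) (t : ℝ) : ℝ :=
  sSup (propagatorValues E A t)

end

end HCDAE

/-! The staircase form reduces the DAE to an ODE `z' = B z`, with `B` the system matrix. In the
staircase coordinates `y`, the fourth block row forces `y₁ = 0`, the third determines `y₃` from
`y₂`, the first determines `y₄`, and `z = E₂₂^{1/2} y₂` satisfies the ODE with `‖x‖_E = ‖z‖`. So
`propagatorValues` are the values `‖exp (t B) z‖` with `‖z‖ = 1` (`exists_lift`, `exists_proj`,
`propagatorValues_eq`), and `B` is again semi-dissipative.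

Write the dissipative part of `B` as `Cᴴ C`. The energy loss up to time `t` is `2 ∫₀ᵗ ‖C exp (s B)
x‖² ds`. The kernels `C x = C B x = ⋯ = 0` form a decreasing chain `obsKer`, and the HC-index `m` is
the first index for which `obsKer (m + 1)` is trivial (`kalmanSum_posDef_iff`). On the `j`-th layer
of this chain `C exp (s B)` starts with the term of order `s ^ j`. Scaling that layer by `t ^ (m -
j)` puts all layers at the common order `t ^ m`, so the loss becomes `t ^ (2m+1)` times a form
independent of `t`, up to a relative error `O(t)` (`exists_energy_bound`). The form is positive
definite, because a polynomial vanishing on `[0, 1]` has zero coefficients (`leadForm_pos`). As `t →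
0` the norm of the scaled vector tends to that of its last layer, so the least loss on the unit
sphere is governed by the minimum of the form subject to a last layer of norm one
(`exists_contraction_expansion`).

The exponent of such an expansion is unique (`exponent_unique`), which gives the converse. It also
gives independence of the staircase form, since the propagator seminorm is defined without reference
to one. Finiteness holds because eigenvectors of `B` lift to eigenvectors of the pencil, so `B` has
no imaginary eigenvalue. -/

namespace HCDAE

/-! ### Observability filtration, its layers and the leading form -/

section Contraction

variable {V W : Type*} [NormedAddCommGroup V] [InnerProductSpace ℂ V]
  [NormedAddCommGroup W] [InnerProductSpace ℂ W]

/-- The vectors `x` with `C Bⁱ x = 0` for all `i < j`. -/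
def obsKer (B : V →L[ℂ] V) (C : V →L[ℂ] W) (j : ℕ) : Submodule ℂ V where
  carrier := {x | ∀ i < j, C ((B ^ i) x) = 0}
  add_mem' := fun ha hb i hi => by rw [map_add, map_add, ha i hi, hb i hi, add_zero]
  zero_mem' := fun i _ => by rw [map_zero, map_zero]
  smul_mem' := fun c x hx i hi => by rw [map_smul, map_smul, hx i hi, smul_zero]

variable (B : V →L[ℂ] V) (C : V →L[ℂ] W)

lemma mem_obsKer {j : ℕ} {x : V} : x ∈ obsKer B C j ↔ ∀ i < j, C ((B ^ i) x) = 0 := Iff.rfl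

lemma obsKer_antitone : Antitone (obsKer B C) :=
  fun _ _ hij _ hx k hk => hx k (hk.trans_le hij)

lemma obsKer_zero : obsKer B C 0 = ⊤ := by
  ext x; simp [mem_obsKer]

variable [FiniteDimensional ℂ V]

/-- The orthogonal projection onto the orthogonal complement of `obsKer B C (j + 1)` in
`obsKer B C j`. -/
noncomputable def layer (j : ℕ) : V →L[ℂ] V :=
  (obsKer B C j).starProjection - (obsKer B C (j + 1)).starProjection

/-- The scaling by `t ^ (m - j)` on the `j`-th layer. -/
noncomputable def dilation (m : ℕ) (t : ℝ) : V →L[ℂ] V :=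
  ∑ j ∈ Finset.range (m + 1), t ^ (m - j) • layer B C j

/-- The leading term of `C exp (s t B)` after scaling. -/
noncomputable def leadTerm (m : ℕ) (s : ℝ) (w : V) : W :=
  ∑ j ∈ Finset.range (m + 1), (s ^ j / (j.factorial : ℝ)) • C ((B ^ j) (layer B C j w))

/-- The leading term of the energy loss after scaling. -/
noncomputable def leadForm (m : ℕ) (w : V) : ℝ :=
  2 * ∫ s in (0 : ℝ)..1, ‖leadTerm B C m s w‖ ^ 2

lemma layer_mem (j : ℕ) (x : V) : layer B C j x ∈ obsKer B C j :=
  sub_mem (Submodule.starProjection_apply_mem _ _)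
    (obsKer_antitone B C j.le_succ (Submodule.starProjection_apply_mem _ _))

lemma layer_mem_orthogonal (j : ℕ) (x : V) : layer B C j x ∈ (obsKer B C (j + 1))ᗮ := by
  have h1 := Submodule.sub_starProjection_mem_orthogonal (K := obsKer B C j) x
  have h2 := Submodule.sub_starProjection_mem_orthogonal (K := obsKer B C (j + 1)) x
  have h3 := sub_mem h2 (Submodule.orthogonal_le (obsKer_antitone B C j.le_succ) h1)
  simpa [layer] using h3

lemma proj_eq_self {i : ℕ} {x : V} (hx : x ∈ obsKer B C i) :
    (obsKer B C i).starProjection x = x := Submodule.starProjection_eq_self_iff.2 hx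

lemma proj_eq_zero {i : ℕ} {x : V} (hx : x ∈ (obsKer B C i)ᗮ) :
    (obsKer B C i).starProjection x = 0 := (Submodule.starProjection_apply_eq_zero_iff _).2 hx

/-- The `obsKer` are nested, so differences of consecutive orthogonal projections are mutually
orthogonal projections. -/
lemma layer_layer (i j : ℕ) (x : V) :
    layer B C i (layer B C j x) = if i = j then layer B C j x else 0 := by
  have hm := layer_mem B C j x
  have ho := layer_mem_orthogonal B C j x
  rcases lt_trichotomy i j with h | h | h
  · rw [if_neg h.ne]
    conv_lhs => rw [layer]
    rw [_root_.sub_apply, proj_eq_self B C (obsKer_antitone B C h.le hm),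
      proj_eq_self B C (obsKer_antitone B C h hm), sub_self]
  · subst h
    rw [if_pos rfl]
    exact (congrArg₂ (· - ·) (proj_eq_self B C hm) (proj_eq_zero B C ho)).trans (sub_zero _)
  · rw [if_neg h.ne']
    conv_lhs => rw [layer]
    rw [_root_.sub_apply,
      proj_eq_zero B C (Submodule.orthogonal_le (obsKer_antitone B C h) ho),
      proj_eq_zero B C
        (Submodule.orthogonal_le (obsKer_antitone B C (Nat.succ_le_succ h.le)) ho), sub_zero]

lemma proj_eq_zero_of_eq_bot {j : ℕ} (hj : obsKer B C j = ⊥) (x : V) :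
    (obsKer B C j).starProjection x = 0 :=
  (Submodule.eq_bot_iff _).1 hj _ (Submodule.starProjection_apply_mem _ _)

/-- The sum telescopes from the projection onto `obsKer B C 0 = ⊤` to the one onto `⊥`. -/
lemma sum_layer {m : ℕ} (hm : obsKer B C (m + 1) = ⊥) (x : V) :
    ∑ j ∈ Finset.range (m + 1), layer B C j x = x := by
  have h := Finset.sum_range_sub' (fun j => (obsKer B C j).starProjection x) (m + 1)
  simp only [layer, _root_.sub_apply]
  rw [h]
  have h0 : (obsKer B C 0).starProjection x = x := proj_eq_self B C (by simp [obsKer_zero])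
  have h1 := proj_eq_zero_of_eq_bot B C hm x
  rw [h0, h1, sub_zero]

lemma layer_eq_zero {j : ℕ} {x : V} (h : C ((B ^ j) (layer B C j x)) = 0) :
    layer B C j x = 0 := by
  have hm : layer B C j x ∈ obsKer B C (j + 1) := by
    intro i hi
    rcases Nat.lt_succ_iff_lt_or_eq.1 hi with h' | h'
    · exact layer_mem B C j x i h'
    · rwa [h']
  have := layer_mem_orthogonal B C j x
  exact (Submodule.disjoint_def.1 (obsKer B C (j + 1)).orthogonal_disjoint) _ hm this

lemma layer_last_of_mem {m : ℕ} (hm : obsKer B C (m + 1) = ⊥) {x : V} (hx : x ∈ obsKer B C m) :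
    layer B C m x = x := by
  rw [layer, _root_.sub_apply, proj_eq_self B C hx, proj_eq_zero_of_eq_bot B C hm, sub_zero]

lemma norm_layer_last_le {m : ℕ} (hm : obsKer B C (m + 1) = ⊥) (x : V) :
    ‖layer B C m x‖ ≤ ‖x‖ := by
  rw [layer, _root_.sub_apply, proj_eq_zero_of_eq_bot B C hm, sub_zero]
  have := (obsKer B C m).starProjection.le_of_opNorm_le
    (Submodule.starProjection_norm_le _) x
  simpa using this

lemma dilation_apply (m : ℕ) (t : ℝ) (w : V) :
    dilation B C m t w = ∑ j ∈ Finset.range (m + 1), t ^ (m - j) • layer B C j w := by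
  simp [dilation]

/-- The last layer carries the factor `t ^ 0`; hence its norm bounds that of the scaled vector from
below, uniformly in `t`. -/
lemma layer_dilation (m : ℕ) (t : ℝ) (w : V) :
    layer B C m (dilation B C m t w) = layer B C m w := by
  have h : ∀ (r : ℝ) (v : V), layer B C m (r • v) = r • layer B C m v :=
    fun r v => by simp
  rw [dilation_apply, map_sum]
  simp [h, layer_layer]

lemma dilation_surjective {m : ℕ} (hm : obsKer B C (m + 1) = ⊥) {t : ℝ} (ht : t ≠ 0) (x : V) :
    ∃ w, dilation B C m t w = x := by
  have h : ∀ (i : ℕ) (r : ℝ) (v : V), layer B C i (r • v) = r • layer B C i v :=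
    fun i r v => by simp
  refine ⟨∑ j ∈ Finset.range (m + 1), (t ^ (m - j))⁻¹ • layer B C j x, ?_⟩
  rw [dilation_apply]
  conv_rhs => rw [← sum_layer B C hm x]
  refine Finset.sum_congr rfl fun i hi => ?_
  have : i < m + 1 := Finset.mem_range.1 hi
  simp [h, layer_layer, ht]
  intro h'
  omega

/-- Taylor expansion of `C exp (s B)` on `obsKer B C j`. -/
lemma exists_taylor_bound (j : ℕ) : ∃ K, 0 ≤ K ∧ ∃ δ : ℝ, 0 < δ ∧ ∀ s : ℝ, 0 ≤ s → s ≤ δ →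
    ∀ v ∈ obsKer B C j,
      ‖C (NormedSpace.exp (s • B) v) - (s ^ j / (j.factorial : ℝ)) • C ((B ^ j) v)‖
        ≤ K * s ^ (j + 1) * ‖v‖ := by
  have : CompleteSpace V := FiniteDimensional.complete ℂ V
  have h := (NormedSpace.exp_hasFPowerSeriesAt_zero (𝕂 := ℝ)
    (𝔸 := V →L[ℂ] V)).isBigO_sub_partialSum_pow (j + 1)
  obtain ⟨K, hK, hb⟩ := h.exists_pos
  rw [Asymptotics.IsBigOWith] at hb
  have ht : Tendsto (fun s : ℝ => s • B) (𝓝 0) (𝓝 0) := by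
    have : Continuous fun s : ℝ => s • B := by fun_prop
    simpa using this.tendsto 0
  obtain ⟨δ, hδ, hball⟩ := Metric.eventually_nhds_iff.1 (ht.eventually hb)
  refine ⟨‖C‖ * (K * ‖B‖ ^ (j + 1)), by positivity, δ / 2, by positivity, fun s hs hsδ v hv => ?_⟩
  have h1 := hball (y := s) (by rw [Real.dist_eq, sub_zero, abs_of_nonneg hs]; linarith)
  -- The partial sum has the terms `0, …, j`; on `obsKer B C j` all but the last are annihilated by
  -- `C`.
  have h2 : C (((NormedSpace.expSeries ℝ (V →L[ℂ] V)).partialSum (j + 1) (s • B)) v)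
      = (s ^ j / (j.factorial : ℝ)) • C ((B ^ j) v) := by
    have hC : ∀ (r : ℝ) (v : V), C (r • v) = r • C v :=
    fun r v => by simp
    have hterm : ∀ i, C (((NormedSpace.expSeries ℝ (V →L[ℂ] V)) i fun _ => s • B) v)
        = (s ^ i / (i.factorial : ℝ)) • C ((B ^ i) v) := fun i => by
      rw [NormedSpace.expSeries_apply_eq, smul_pow, smul_smul, _root_.smul_apply, hC]
      congr 1
      field_simp
    rw [FormalMultilinearSeries.partialSum, _root_.sum_apply, map_sum]
    simp_rw [hterm]
    rw [Finset.sum_range_succ, Finset.sum_eq_zero, zero_add]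
    intro i hi
    rw [hv i (Finset.mem_range.1 hi), smul_zero]
  rw [← h2, ← map_sub, ← _root_.sub_apply]
  rw [zero_add, norm_pow, norm_norm, norm_smul, Real.norm_of_nonneg hs] at h1
  calc _ ≤ ‖C‖ * (‖NormedSpace.exp (s • B) - (NormedSpace.expSeries ℝ (V →L[ℂ] V)).partialSum
        (j + 1) (s • B)‖ * ‖v‖) := (C.le_opNorm _).trans (by
          gcongr; exact ContinuousLinearMap.le_opNorm _ _)
    _ ≤ ‖C‖ * ((K * (s * ‖B‖) ^ (j + 1)) * ‖v‖) := by gcongr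
    _ = _ := by ring

/-- After scaling, `C exp (s t B)` is `t ^ m` times its leading term, up to a relative error of
order `t`. -/
lemma exists_leadTerm_bound (m : ℕ) : ∃ K, 0 ≤ K ∧ ∃ δ : ℝ, 0 < δ ∧ ∀ t : ℝ, 0 ≤ t → t ≤ δ →
    ∀ s : ℝ, 0 ≤ s → s ≤ 1 → ∀ w,
      ‖C (NormedSpace.exp (s • t • B) (dilation B C m t w)) - t ^ m • leadTerm B C m s w‖
        ≤ K * t ^ (m + 1) * ‖w‖ := by
  choose K hK δ hδ hb using exists_taylor_bound B C
  have hC : ∀ (r : ℝ) (v : V), C (r • v) = r • C v :=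
    fun r v => by simp
  have hexp : ∀ (T : V →L[ℂ] V) (r : ℝ) (v : V), T (r • v) = r • T v :=
    fun T r v => by simp
  let δ' := (Finset.range (m + 1)).inf' (by simp) δ
  have hδ' : 0 < δ' := by
    rw [Finset.lt_inf'_iff]; exact fun i _ => hδ i
  refine ⟨∑ j ∈ Finset.range (m + 1), K j * ‖layer B C j‖, Finset.sum_nonneg fun j _ =>
    mul_nonneg (hK j) (norm_nonneg _), δ', hδ', fun t ht0 ht s hs0 hs w => ?_⟩
  rw [dilation_apply, map_sum, map_sum, leadTerm, Finset.smul_sum, ← Finset.sum_sub_distrib,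
    Finset.sum_mul, Finset.sum_mul]
  refine norm_sum_le_of_le _ fun j hj => ?_
  have hj' : j ≤ m := Nat.lt_succ_iff.1 (Finset.mem_range.1 hj)
  have hst : s * t ≤ δ j := by
    have : δ' ≤ δ j := Finset.inf'_le _ hj
    nlinarith
  have h1 := hb j (s * t) (by positivity) hst _ (layer_mem B C j w)
  -- The factor `t ^ (m - j)` and the `t ^ j` of the Taylor term combine to `t ^ m`, whatever the
  -- layer.
  have h2 : C (NormedSpace.exp (s • t • B) (t ^ (m - j) • layer B C j w))
      - t ^ m • (s ^ j / (j.factorial : ℝ)) • C ((B ^ j) (layer B C j w))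
      = t ^ (m - j) • (C (NormedSpace.exp ((s * t) • B) (layer B C j w))
        - ((s * t) ^ j / (j.factorial : ℝ)) • C ((B ^ j) (layer B C j w))) := by
    rw [hexp, hC, smul_sub, smul_smul, smul_smul, smul_smul]
    congr 2
    rw [← pow_sub_mul_pow t hj']
    ring
  rw [h2, norm_smul, Real.norm_of_nonneg (by positivity)]
  calc t ^ (m - j) * _ ≤ t ^ (m - j) * (K j * (s * t) ^ (j + 1) * ‖layer B C j w‖) := by gcongr
    _ ≤ t ^ (m - j) * (K j * (1 * t) ^ (j + 1) * (‖layer B C j‖ * ‖w‖)) := by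
        have := hK j
        gcongr
        exact ContinuousLinearMap.le_opNorm _ _
    _ = K j * ‖layer B C j‖ * (t ^ (m - j) * t ^ j * t) * ‖w‖ := by ring
    _ = K j * ‖layer B C j‖ * t ^ (m + 1) * ‖w‖ := by rw [pow_sub_mul_pow t hj', pow_succ]

lemma continuous_leadTerm (m : ℕ) : Continuous fun p : V × ℝ => leadTerm B C m p.2 p.1 := by
  unfold leadTerm
  fun_prop

lemma continuous_leadForm (m : ℕ) : Continuous (leadForm B C m) := by
  unfold leadForm
  refine continuous_const.mul
    (intervalIntegral.continuous_parametric_intervalIntegral_of_continuous' ?_ 0 1)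
  exact (continuous_leadTerm B C m).norm.pow 2

lemma leadTerm_smul (m : ℕ) (s a : ℝ) (w : V) :
    leadTerm B C m s (a • w) = a • leadTerm B C m s w := by
  have hexp : ∀ (T : V →L[ℂ] V) (r : ℝ) (v : V), T (r • v) = r • T v :=
    fun T r v => by simp
  have hC : ∀ (r : ℝ) (v : V), C (r • v) = r • C v :=
    fun r v => by simp
  simp only [leadTerm, hexp, hC, Finset.smul_sum]
  exact Finset.sum_congr rfl fun j _ => smul_comm _ _ _

lemma leadForm_smul (m : ℕ) (a : ℝ) (w : V) :
    leadForm B C m (a • w) = a ^ 2 * leadForm B C m w := by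
  simp only [leadForm, leadTerm_smul, norm_smul, mul_pow, intervalIntegral.integral_const_mul,
    Real.norm_eq_abs, sq_abs]
  ring

/-- If the integral vanished, so would the polynomial `s ↦ leadTerm B C m s w` on `[0, 1]`, hence
each coefficient `C Bʲ wⱼ`; this puts the layer `wⱼ` in `obsKer (j + 1)`, to which it is orthogonal.
-/
lemma leadForm_pos {m : ℕ} (hm : obsKer B C (m + 1) = ⊥) {w : V} (hw : w ≠ 0) :
    0 < leadForm B C m w := by
  have hc : Continuous fun s : ℝ => leadTerm B C m s w :=
    (continuous_leadTerm B C m).comp (Continuous.prodMk_right w)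
  refine mul_pos two_pos (intervalIntegral.integral_pos one_pos
    (hc.norm.pow 2).continuousOn (fun _ _ => by positivity) ?_)
  by_contra! hcon
  have hzero : ∀ s ∈ Icc (0 : ℝ) 1, leadTerm B C m s w = 0 := fun s hs => by
    have := hcon s hs
    simpa using le_antisymm this (by positivity)
  apply hw
  rw [← sum_layer B C hm w]
  refine Finset.sum_eq_zero fun k hk => layer_eq_zero B C ?_
  set u := C ((B ^ k) (layer B C k w)) with hu
  -- Pairing with `u` makes the polynomial scalar; its `k`-th coefficient is `‖u‖² / k!`.
  let p : Polynomial ℂ := ∑ j ∈ Finset.range (m + 1), Polynomial.monomial j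
    (((j.factorial : ℝ) : ℂ)⁻¹ * inner ℂ u (C ((B ^ j) (layer B C j w))))
  have hroot : ∀ s ∈ Icc (0 : ℝ) 1, p.IsRoot (s : ℂ) := fun s hs => by
    have h0 := congrArg (fun y => inner ℂ u y) (hzero s hs)
    simp only [leadTerm, inner_sum, inner_zero_right] at h0
    rw [Polynomial.IsRoot, Polynomial.eval_finsetSum, ← h0]
    refine Finset.sum_congr rfl fun j _ => ?_
    rw [Polynomial.eval_monomial, ← Complex.coe_smul, inner_smul_right]
    push_cast
    ring
  have hp : p = 0 := by
    refine Polynomial.eq_zero_of_infinite_isRoot p (Set.Infinite.mono ?_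
      ((Icc_infinite (zero_lt_one (α := ℝ))).image Complex.ofReal_injective.injOn))
    rintro _ ⟨s, hs, rfl⟩
    exact hroot s hs
  have hk0 := congrArg (fun q => Polynomial.coeff q k) hp
  simp only [p, Polynomial.finsetSum_coeff, Polynomial.coeff_monomial, Polynomial.coeff_zero,
    Finset.sum_ite_eq', hk, if_true, mul_eq_zero, inv_eq_zero] at hk0
  rcases hk0 with h | h
  · exact absurd (by exact_mod_cast h) k.factorial_ne_zero
  · exact inner_self_eq_zero.1 h

end Contraction

lemma abs_norm_sq_sub_norm_sq_le {X : Type*} [SeminormedAddCommGroup X] {a b : X} {α β : ℝ} (hb : ‖b‖ ≤ α) (hab : ‖a - b‖ ≤ β) :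
    |‖a‖ ^ 2 - ‖b‖ ^ 2| ≤ (2 * α + β) * β := by
  have h1 : |‖a‖ - ‖b‖| ≤ β := (abs_norm_sub_norm_le a b).trans hab
  have h2 : ‖a‖ ≤ α + β := by
    have := norm_le_norm_add_norm_sub' a b
    linarith
  have h3 : ‖a‖ ^ 2 - ‖b‖ ^ 2 = (‖a‖ + ‖b‖) * (‖a‖ - ‖b‖) := by ring
  rw [h3, abs_mul, abs_of_nonneg (by positivity)]
  have := abs_nonneg (‖a‖ - ‖b‖)
  exact mul_le_mul (by linarith) h1 this (by linarith [norm_nonneg a, norm_nonneg b])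

/-! ### Energy loss and short-time expansion of a contraction semigroup -/

section Contraction

variable {V W : Type*} [NormedAddCommGroup V] [InnerProductSpace ℂ V]
  [NormedAddCommGroup W] [InnerProductSpace ℂ W] (B : V →L[ℂ] V) (C : V →L[ℂ] W)

lemma exp_zero_smul_apply (x : V) : NormedSpace.exp ((0 : ℝ) • B) x = x := by
  rw [zero_smul, NormedSpace.exp_zero, one_apply_eq_self]

lemma hasDerivAt_norm_sq_of_dissipative (hB : ∀ x, (inner ℂ x (B x)).re = -‖C x‖ ^ 2)
    {y : ℝ → V} {t : ℝ} (hy : HasDerivAt y (B (y t)) t) :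
    HasDerivAt (fun s => ‖y s‖ ^ 2) (-2 * ‖C (y t)‖ ^ 2) t := by
  let _ : InnerProductSpace ℝ V := InnerProductSpace.rclikeToReal ℂ V
  have h : HasDerivAt (fun s => ‖y s‖ ^ 2) (2 * inner ℝ (y t) (B (y t))) t := HasDerivAt.norm_sq hy
  rw [real_inner_eq_re_inner ℂ] at h
  have h2 : RCLike.re (inner ℂ (y t) (B (y t))) = -‖C (y t)‖ ^ 2 := hB _
  rw [h2] at h
  convert h using 1
  ring

variable [FiniteDimensional ℂ V]

lemma hasDerivAt_exp_smul_apply (x : V) (t : ℝ) :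
    HasDerivAt (fun s : ℝ => NormedSpace.exp (s • B) x) (B (NormedSpace.exp (t • B) x)) t := by
  have : CompleteSpace V := FiniteDimensional.complete ℂ V
  have h := hasDerivAt_exp_smul_const' (𝕂 := ℝ) B t
  let ev : (V →L[ℂ] V) →L[ℝ] V := (ContinuousLinearMap.apply ℂ V x).restrictScalars ℝ
  exact ev.hasFDerivAt.comp_hasDerivAt t h

/-- Integrates `d/dt ‖y‖² = -2 ‖C y‖²`. Time is rescaled to `[0, 1]` so that the domain of
integration does not depend on `t`. -/
lemma energy_identity (hB : ∀ x, (inner ℂ x (B x)).re = -‖C x‖ ^ 2) (t : ℝ) (x : V) :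
    ‖x‖ ^ 2 - ‖NormedSpace.exp (t • B) x‖ ^ 2
      = 2 * t * ∫ s in (0 : ℝ)..1, ‖C (NormedSpace.exp (s • t • B) x)‖ ^ 2 := by
  have hder : ∀ s : ℝ, HasDerivAt (fun r : ℝ => ‖NormedSpace.exp (r • t • B) x‖ ^ 2)
      (-(2 * t) * ‖C (NormedSpace.exp (s • t • B) x)‖ ^ 2) s := fun s => by
    have h1 := (hasDerivAt_norm_sq_of_dissipative B C hB
      (hasDerivAt_exp_smul_apply B x (s * t))).scomp s ((hasDerivAt_id s).mul_const t)
    simp only [smul_smul]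
    refine h1.congr_deriv ?_
    rw [smul_eq_mul]
    ring
  have hcont : Continuous fun s : ℝ =>
      -(2 * t) * ‖C (NormedSpace.exp (s • t • B) x)‖ ^ 2 := by
    have : Continuous fun s : ℝ => NormedSpace.exp (s • t • B) x :=
      continuous_iff_continuousAt.2 fun s => (hasDerivAt_exp_smul_apply (t • B) x s).continuousAt
    fun_prop
  have h := intervalIntegral.integral_eq_sub_of_hasDerivAt (a := 0) (b := 1)
    (fun s _ => hder s) (hcont.intervalIntegrable _ _)
  rw [intervalIntegral.integral_const_mul] at h
  simp only [one_smul, zero_smul, NormedSpace.exp_zero, one_apply_eq_self] at h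
  linarith

lemma norm_exp_apply_le (hB : ∀ x, (inner ℂ x (B x)).re = -‖C x‖ ^ 2) {t : ℝ} (ht : 0 ≤ t)
    (x : V) : ‖NormedSpace.exp (t • B) x‖ ≤ ‖x‖ := by
  have h := energy_identity B C hB t x
  have h1 : 0 ≤ ∫ s in (0 : ℝ)..1, ‖C (NormedSpace.exp (s • t • B) x)‖ ^ 2 :=
    intervalIntegral.integral_nonneg zero_le_one fun _ _ => by positivity
  have h2 : 0 ≤ 2 * t * ∫ s in (0 : ℝ)..1, ‖C (NormedSpace.exp (s • t • B) x)‖ ^ 2 := by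
    positivity
  exact (sq_le_sq₀ (norm_nonneg _) (norm_nonneg _)).1 (by linarith)

/-- After scaling, the energy loss is `t ^ (2 m + 1)` times its leading form, up to a relative
error of order `t`. -/
lemma exists_energy_bound (hB : ∀ x, (inner ℂ x (B x)).re = -‖C x‖ ^ 2) (m : ℕ) :
    ∃ K, 0 ≤ K ∧ ∃ δ : ℝ, 0 < δ ∧ ∀ t : ℝ, 0 ≤ t → t ≤ δ → ∀ w,
      |‖dilation B C m t w‖ ^ 2 - ‖NormedSpace.exp (t • B) (dilation B C m t w)‖ ^ 2
        - t ^ (2 * m + 1) * leadForm B C m w| ≤ K * t ^ (2 * m + 2) * ‖w‖ ^ 2 := by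
  obtain ⟨K, hK, δ, hδ, hb⟩ := exists_leadTerm_bound B C m
  obtain ⟨M, hM, hMb⟩ : ∃ M, 0 ≤ M ∧ ∀ s ∈ Icc (0 : ℝ) 1, ∀ w,
      ‖leadTerm B C m s w‖ ≤ M * ‖w‖ := by
    refine ⟨∑ j ∈ Finset.range (m + 1), ‖C‖ * (‖B ^ j‖ * ‖layer B C j‖),
      Finset.sum_nonneg fun _ _ => by positivity, fun s hs w => ?_⟩
    rw [leadTerm, Finset.sum_mul]
    refine norm_sum_le_of_le _ fun j _ => ?_
    have h1 : ‖s ^ j / (j.factorial : ℝ)‖ ≤ 1 := by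
      rw [Real.norm_of_nonneg (div_nonneg (pow_nonneg hs.1 _) (by positivity))]
      refine div_le_one_of_le₀ ((pow_le_one₀ hs.1 hs.2).trans ?_) (by positivity)
      exact_mod_cast j.factorial_pos
    have h2 : ‖C ((B ^ j) (layer B C j w))‖ ≤ ‖C‖ * (‖B ^ j‖ * (‖layer B C j‖ * ‖w‖)) :=
      C.le_opNorm_of_le ((B ^ j).le_opNorm_of_le ((layer B C j).le_opNorm w))
    rw [norm_smul]
    calc _ ≤ 1 * (‖C‖ * (‖B ^ j‖ * (‖layer B C j‖ * ‖w‖))) := by gcongr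
      _ = _ := by ring
  -- The bound comes from `|‖a‖² - ‖b‖²| ≤ (2α + β) β` with `α = t ^ m * M * ‖w‖` and `β = K * t ^
  -- (m + 1) * ‖w‖`; `t ≤ 1` absorbs the extra `t` in `2 * M + K * t`.
  refine ⟨2 * ((2 * M + K) * K), by positivity, min δ 1, by positivity, fun t ht0 ht w => ?_⟩
  have htδ := ht.trans (min_le_left _ _)
  have ht1 := ht.trans (min_le_right _ _)
  rw [energy_identity B C hB]
  have hc1 : Continuous fun s : ℝ =>
      ‖C (NormedSpace.exp (s • t • B) (dilation B C m t w))‖ ^ 2 := by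
    have : Continuous fun s : ℝ => NormedSpace.exp (s • t • B) (dilation B C m t w) :=
      continuous_iff_continuousAt.2 fun s => (hasDerivAt_exp_smul_apply (t • B) _ s).continuousAt
    fun_prop
  have hc2 : Continuous fun s : ℝ => ‖t ^ m • leadTerm B C m s w‖ ^ 2 :=
    (((continuous_leadTerm B C m).comp (Continuous.prodMk_right w)).const_smul _).norm.pow 2
  have hlead : t ^ (2 * m + 1) * leadForm B C m w
      = 2 * t * ∫ s in (0 : ℝ)..1, ‖t ^ m • leadTerm B C m s w‖ ^ 2 := by
    simp only [norm_smul, mul_pow, intervalIntegral.integral_const_mul, leadForm,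
      Real.norm_eq_abs, sq_abs]
    ring
  rw [hlead, ← mul_sub, ← intervalIntegral.integral_sub (hc1.intervalIntegrable _ _)
    (hc2.intervalIntegrable _ _), abs_mul, abs_of_nonneg (by positivity)]
  have hI := intervalIntegral.norm_integral_le_of_norm_le_const (a := 0) (b := 1)
    (C := (2 * M + K) * K * t ^ (2 * m + 1) * ‖w‖ ^ 2)
    (f := fun s : ℝ => ‖C (NormedSpace.exp (s • t • B) (dilation B C m t w))‖ ^ 2
      - ‖t ^ m • leadTerm B C m s w‖ ^ 2) (fun s hs => by
      rw [uIoc_of_le zero_le_one] at hs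
      have h1 := hb t ht0 htδ s hs.1.le hs.2 w
      have h2 : ‖t ^ m • leadTerm B C m s w‖ ≤ t ^ m * (M * ‖w‖) := by
        rw [norm_smul, Real.norm_of_nonneg (by positivity)]
        have := hMb s ⟨hs.1.le, hs.2⟩ w
        gcongr
      refine (abs_norm_sq_sub_norm_sq_le h2 h1).trans ?_
      calc (2 * (t ^ m * (M * ‖w‖)) + K * t ^ (m + 1) * ‖w‖) * (K * t ^ (m + 1) * ‖w‖)
          = (2 * M + K * t) * K * t ^ (2 * m + 1) * ‖w‖ ^ 2 := by ring
        _ ≤ (2 * M + K * 1) * K * t ^ (2 * m + 1) * ‖w‖ ^ 2 := by gcongr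
        _ = _ := by ring)
  rw [Real.norm_eq_abs, sub_zero, abs_one, mul_one] at hI
  calc _ ≤ 2 * t * ((2 * M + K) * K * t ^ (2 * m + 1) * ‖w‖ ^ 2) := by gcongr
    _ = _ := by ring

/-- Compactness of the unit sphere and homogeneity of degree two turn positivity into coercivity. -/
lemma exists_leadForm_ge {m : ℕ} (hm : obsKer B C (m + 1) = ⊥) :
    ∃ c, 0 < c ∧ ∀ w, c * ‖w‖ ^ 2 ≤ leadForm B C m w := by
  have hproper : ProperSpace V := FiniteDimensional.proper ℂ V
  rcases subsingleton_or_nontrivial V with hV | hV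
  · refine ⟨1, one_pos, fun w => ?_⟩
    rw [Subsingleton.elim w 0]
    have := leadForm_smul B C m 0 0
    simp only [zero_smul] at this
    rw [this]
    simp
  obtain ⟨u, hu, hmin⟩ := (isCompact_sphere (0 : V) 1).exists_isMinOn
    (by
      obtain ⟨x, hx⟩ := exists_ne (0 : V)
      exact ⟨((‖x‖⁻¹ : ℝ) : ℂ) • x, by simp [norm_smul, hx]⟩)
    (continuous_leadForm B C m).continuousOn
  have hu0 : u ≠ 0 := ne_zero_of_mem_unit_sphere ⟨u, hu⟩
  refine ⟨leadForm B C m u, leadForm_pos B C hm hu0, fun w => ?_⟩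
  rcases eq_or_ne w 0 with rfl | hw
  · have := leadForm_smul B C m 0 0
    simp only [zero_smul] at this
    rw [this]
    simp
  · have h1 : leadForm B C m u ≤ leadForm B C m (‖w‖⁻¹ • w) := hmin (by simp [norm_smul, hw])
    rw [leadForm_smul] at h1
    have : 0 < ‖w‖ := norm_pos_iff.2 hw
    field_simp at h1
    linarith

/-- The minimum of the leading form on `‖layer m w‖ = 1`. -/
lemma exists_leadForm_min {m : ℕ} (hm : obsKer B C (m + 1) = ⊥) (hm' : obsKer B C m ≠ ⊥) :
    ∃ w₀, ‖layer B C m w₀‖ = 1 ∧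
      ∀ w, leadForm B C m w₀ * ‖layer B C m w‖ ^ 2 ≤ leadForm B C m w := by
  have hproper : ProperSpace V := FiniteDimensional.proper ℂ V
  obtain ⟨c, hc, hcb⟩ := exists_leadForm_ge B C hm
  obtain ⟨x, hx, hx0⟩ := (Submodule.ne_bot_iff _).1 hm'
  have hxn : 0 < ‖x‖ := norm_pos_iff.2 hx0
  have hl : ∀ (r : ℝ) (v : V), layer B C m (r • v) = r • layer B C m v := fun r v => by simp
  let S : Set V := {w | ‖layer B C m w‖ = 1}
  have hS : IsClosed S := isClosed_eq (by fun_prop) continuous_const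
  have hx1 : ‖x‖⁻¹ • x ∈ S := by
    simp [S, layer_last_of_mem B C hm hx, norm_smul, hxn.ne']
  -- The constraint set need not be bounded, since it fixes only the last layer; a minimiser exists
  -- because `leadForm` is coercive.
  obtain ⟨w₀, hw₀, hmin⟩ := (continuous_leadForm B C m).continuousOn.exists_isMinOn' hS hx1 (by
    refine Filter.Eventually.filter_mono inf_le_left ?_
    have ht : Tendsto (fun w : V => c * ‖w‖ ^ 2) (cocompact V) atTop :=
      ((tendsto_pow_atTop two_ne_zero).comp (tendsto_norm_cocompact_atTop)).const_mul_atTop hc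
    filter_upwards [ht.eventually_ge_atTop (leadForm B C m (‖x‖⁻¹ • x))] with w hw
    exact hw.trans (hcb w))
  refine ⟨w₀, hw₀, fun w => ?_⟩
  rcases eq_or_ne ‖layer B C m w‖ 0 with h | h
  · rw [h]
    have := hcb w
    have : 0 ≤ c * ‖w‖ ^ 2 := by positivity
    nlinarith
  · have h0 : 0 < ‖layer B C m w‖ := lt_of_le_of_ne (norm_nonneg _) h.symm
    have h1 : leadForm B C m w₀ ≤ leadForm B C m (‖layer B C m w‖⁻¹ • w) :=
      hmin (by simp [S, norm_smul, h])
    rw [leadForm_smul] at h1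
    field_simp at h1
    linarith

set_option maxHeartbeats 400000 in
/-- Short-time expansion of the contraction `exp (t B)`, when `m` is the least number with
`C x = C B x = ⋯ = C Bᵐ x = 0 → x = 0`. -/
theorem exists_contraction_expansion (hB : ∀ x, (inner ℂ x (B x)).re = -‖C x‖ ^ 2) {m : ℕ}
    (hm : obsKer B C (m + 1) = ⊥) (hm' : obsKer B C m ≠ ⊥) :
    ∃ c, 0 < c ∧ ∃ K, 0 ≤ K ∧ ∃ δ : ℝ, 0 < δ ∧ ∀ t : ℝ, 0 < t → t ≤ δ →
      (∀ x, ‖x‖ = 1 → ‖NormedSpace.exp (t • B) x‖ ^ 2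
        ≤ 1 - c * t ^ (2 * m + 1) + K * t ^ (2 * m + 2)) ∧
      ∃ x, ‖x‖ = 1 ∧ 1 - c * t ^ (2 * m + 1) - K * t ^ (2 * m + 2)
        ≤ ‖NormedSpace.exp (t • B) x‖ ^ 2 := by
  obtain ⟨w₀, hw₀, hmin⟩ := exists_leadForm_min B C hm hm'
  obtain ⟨c₁, hc₁, hcb⟩ := exists_leadForm_ge B C hm
  obtain ⟨K, hK, δ, hδ, hb⟩ := exists_energy_bound B C hB m
  set c := leadForm B C m w₀ with hc
  have hw₀0 : w₀ ≠ 0 := by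
    rintro rfl
    simp at hw₀
  have hcpos : 0 < c := leadForm_pos B C hm hw₀0
  -- Every layer except the last is scaled by a positive power of `t`.
  obtain ⟨D, hD, hDb⟩ : ∃ D, 0 ≤ D ∧ ∀ t : ℝ, 0 ≤ t → t ≤ 1 → ∀ w,
      ‖dilation B C m t w‖ ≤ ‖layer B C m w‖ + D * t * ‖w‖ := by
    refine ⟨∑ j ∈ Finset.range m, ‖layer B C j‖, Finset.sum_nonneg fun _ _ => norm_nonneg _,
      fun t ht0 ht1 w => ?_⟩
    rw [dilation_apply, Finset.sum_range_succ, Nat.sub_self, pow_zero, one_smul, add_comm]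
    refine (norm_add_le _ _).trans (add_le_add le_rfl ?_)
    rw [Finset.sum_mul, Finset.sum_mul]
    refine norm_sum_le_of_le _ fun j hj => ?_
    rw [norm_smul, Real.norm_of_nonneg (by positivity)]
    have h1 : t ^ (m - j) ≤ t := by
      have := pow_le_pow_of_le_one ht0 ht1 (show 1 ≤ m - j by
        have := Finset.mem_range.1 hj
        omega)
      simpa using this
    calc _ ≤ t * (‖layer B C j‖ * ‖w‖) := by
          gcongr
          exact ContinuousLinearMap.le_opNorm _ _
      _ = _ := by ring
  -- `M` bounds `‖w‖` whenever `leadForm B C m w ≤ 2 * c`. The summands of `K'` pay for the energy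
  -- error at the minimiser `w₀`, for the deviation of `‖layer m w‖²` from `1`, and for the energy
  -- error at a `w` with leading form at most `2 * c`.
  set M := √(2 * c / c₁) with hM
  set K' := K * ‖w₀‖ ^ 2 + c * (2 * (D * M)) + 2 * c * (K / c₁) with hK'
  have hK'0 : 0 ≤ K' := by positivity
  refine ⟨c, hcpos, K', hK'0,
    min (min δ 1) (min (1 / (2 * K / c₁ + 1)) (1 / (D * M + 1))), by positivity,
    fun t ht0 ht => ⟨fun x hx => ?_, ?_⟩⟩
  · have htδ := (ht.trans (min_le_left _ _)).trans (min_le_left _ _)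
    have ht1 := (ht.trans (min_le_left _ _)).trans (min_le_right _ _)
    have ht2 := (ht.trans (min_le_right _ _)).trans (min_le_left _ _)
    have ht3 := (ht.trans (min_le_right _ _)).trans (min_le_right _ _)
    rw [le_div_iff₀ (by positivity)] at ht2 ht3
    obtain ⟨w, rfl⟩ := dilation_surjective B C hm ht0.ne' x
    have h1 := (abs_le.1 (hb t ht0.le htδ w)).1
    rw [hx] at h1
    have h2 := hmin w
    have h3 := hcb w
    have h4 := hDb t ht0.le ht1 w
    rw [hx] at h4
    set v := leadForm B C m w
    have hKt : K * ‖w‖ ^ 2 ≤ K / c₁ * v := by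
      have : K / c₁ * (c₁ * ‖w‖ ^ 2) ≤ K / c₁ * v := by gcongr
      calc K * ‖w‖ ^ 2 = K / c₁ * (c₁ * ‖w‖ ^ 2) := by field_simp
        _ ≤ _ := this
    -- If `v ≥ 2 * c`, the error costs at most half of `v`, which leaves at least `c`. Otherwise
    -- `‖w‖ ≤ M`, so the last layer has norm at least `1 - D * M * t` and minimality of `c` applies.
    have hv : c - K' * t ≤ v - t * (K / c₁ * v) := by
      rcases le_total (2 * c) v with hv | hv
      · have ha : 2 * (t * (K / c₁)) ≤ 1 := by
          have : t * (2 * K / c₁ + 1) = 2 * (t * (K / c₁)) + t := by ring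
          linarith
        have : 0 ≤ K' * t := by positivity
        nlinarith
      · have hwM : ‖w‖ ≤ M := by
          rw [hM]
          refine Real.le_sqrt_of_sq_le ?_
          rw [le_div_iff₀ hc₁]
          linarith
        have h5 : 1 - D * M * t ≤ ‖layer B C m w‖ := by
          have : D * t * ‖w‖ ≤ D * t * M := by gcongr
          linarith
        have h6 : 0 ≤ 1 - D * M * t := by nlinarith
        have h7 : 1 - 2 * (D * M) * t ≤ ‖layer B C m w‖ ^ 2 := by
          have := pow_le_pow_left₀ h6 h5 2
          nlinarith [sq_nonneg (D * M * t)]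
        have h8 : c * (1 - 2 * (D * M) * t) ≤ v := le_trans (by gcongr) h2
        have h9 : t * (K / c₁ * v) ≤ t * (K / c₁ * (2 * c)) := by gcongr
        have h10 : 0 ≤ K * ‖w₀‖ ^ 2 * t := by positivity
        rw [hK']
        linarith
    have h5 : t ^ (2 * m + 1) * (c - K' * t) ≤ t ^ (2 * m + 1) * (v - t * (K / c₁ * v)) := by
      gcongr
    have h6 : t ^ (2 * m + 2) * (K * ‖w‖ ^ 2) ≤ t ^ (2 * m + 2) * (K / c₁ * v) := by gcongr
    have h7 : t ^ (2 * m + 2) = t ^ (2 * m + 1) * t := pow_succ _ _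
    rw [h7] at h6 h1 ⊢
    linarith
  · have htδ := (ht.trans (min_le_left _ _)).trans (min_le_left _ _)
    set y := dilation B C m t w₀ with hy
    have h1 := (abs_le.1 (hb t ht0.le htδ w₀)).2
    rw [← hy, ← hc] at h1
    -- With `‖y‖ ≥ 1`, normalising `y` can only reduce the loss, so no expansion of `‖y‖` is needed.
    have hy1 : 1 ≤ ‖y‖ := by
      rw [← hw₀, ← layer_dilation B C m t w₀]
      exact norm_layer_last_le B C hm _
    have hy0 : 0 < ‖y‖ := by linarith
    refine ⟨‖y‖⁻¹ • y, by simp [norm_smul, hy0.ne'], ?_⟩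
    have h2 : NormedSpace.exp (t • B) (‖y‖⁻¹ • y) = ‖y‖⁻¹ • NormedSpace.exp (t • B) y := by simp
    rw [h2, norm_smul, norm_inv, norm_norm, mul_pow]
    have h3 : K * t ^ (2 * m + 2) * ‖w₀‖ ^ 2 ≤ K' * t ^ (2 * m + 2) := by
      have : K * ‖w₀‖ ^ 2 ≤ K' := by
        rw [hK', add_assoc]
        exact le_add_of_nonneg_right (by positivity)
      calc _ = K * ‖w₀‖ ^ 2 * t ^ (2 * m + 2) := by ring
        _ ≤ _ := by gcongr
    set r := c * t ^ (2 * m + 1) + K' * t ^ (2 * m + 2) with hr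
    have hr0 : 0 ≤ r := by positivity
    have h4 : ‖y‖ ^ 2 - r ≤ ‖NormedSpace.exp (t • B) y‖ ^ 2 := by linarith
    have h5 : 1 - r ≤ (‖y‖⁻¹) ^ 2 * (‖y‖ ^ 2 - r) := by
      have : (‖y‖⁻¹) ^ 2 ≤ 1 := pow_le_one₀ (by positivity) (inv_le_one_of_one_le₀ hy1)
      have e : (‖y‖⁻¹) ^ 2 * ‖y‖ ^ 2 = 1 := by field_simp
      nlinarith
    have h6 : (‖y‖⁻¹) ^ 2 * (‖y‖ ^ 2 - r)
        ≤ (‖y‖⁻¹) ^ 2 * ‖NormedSpace.exp (t • B) y‖ ^ 2 := by gcongr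
    linarith

/-- The expansion of the norm of the contraction, given as a least upper bound. -/
theorem exists_isBigO_of_isLUB (hB : ∀ x, (inner ℂ x (B x)).re = -‖C x‖ ^ 2) {m : ℕ}
    (hm : obsKer B C (m + 1) = ⊥) (hm' : obsKer B C m ≠ ⊥) {N : ℝ → ℝ}
    (hN : ∀ t, 0 < t → IsLUB {s | ∃ x, ‖x‖ = 1 ∧ s = ‖NormedSpace.exp (t • B) x‖} (N t)) :
    ∃ c, 0 < c ∧ (fun t : ℝ => N t - (1 - c * t ^ (2 * m + 1)))
      =O[𝓝[>] 0] (fun t : ℝ => t ^ (2 * m + 1 + 1)) := by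
  obtain ⟨c, hc, K, hK, δ, hδ, h⟩ := exists_contraction_expansion B C hB hm hm'
  -- The expansion known so far is that of `N t ^ 2`; the square root halves the coefficient. The
  -- factor `2` is the inverse of the lower bound `1 / 2` for `N t + (1 - c / 2 * p)`, which divides
  -- a difference of squares.
  refine ⟨c / 2, by positivity, Asymptotics.IsBigO.of_bound (2 * (K + c ^ 2)) ?_⟩
  have hI : Ioc (0 : ℝ) (min (min δ 1) (1 / c)) ∈ 𝓝[>] (0 : ℝ) :=
    Ioc_mem_nhdsGT (by positivity)
  filter_upwards [hI] with t ht
  obtain ⟨ht0, ht⟩ := ht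
  have htδ := (ht.trans (min_le_left _ _)).trans (min_le_left _ _)
  have ht1 := (ht.trans (min_le_left _ _)).trans (min_le_right _ _)
  have ht2 := ht.trans (min_le_right _ _)
  rw [le_div_iff₀ hc] at ht2
  obtain ⟨hu, x, hx, hl⟩ := h t ht0 htδ
  have hlub := hN t ht0
  have hN0 : 0 ≤ N t := (norm_nonneg _).trans (hlub.1 ⟨x, hx, rfl⟩)
  have hlow : 1 - c * t ^ (2 * m + 1) - K * t ^ (2 * m + 2) ≤ N t ^ 2 :=
    hl.trans (pow_le_pow_left₀ (norm_nonneg _) (hlub.1 ⟨x, hx, rfl⟩) 2)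
  have hup : N t ^ 2 ≤ 1 - c * t ^ (2 * m + 1) + K * t ^ (2 * m + 2) := by
    have h0 : 0 ≤ 1 - c * t ^ (2 * m + 1) + K * t ^ (2 * m + 2) := (sq_nonneg _).trans (hu x hx)
    have : N t ≤ √(1 - c * t ^ (2 * m + 1) + K * t ^ (2 * m + 2)) := by
      refine hlub.2 ?_
      rintro _ ⟨z, hz, rfl⟩
      exact Real.le_sqrt_of_sq_le (hu z hz)
    calc N t ^ 2 ≤ √(1 - c * t ^ (2 * m + 1) + K * t ^ (2 * m + 2)) ^ 2 :=
          pow_le_pow_left₀ hN0 this 2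
      _ = _ := Real.sq_sqrt h0
  set p := t ^ (2 * m + 1) with hp
  have hp0 : 0 < p := by positivity
  have hpt : p ≤ t := by
    have := pow_le_pow_of_le_one ht0.le ht1 (show 1 ≤ 2 * m + 1 by omega)
    simpa using this
  have hq : t ^ (2 * m + 2) = p * t := pow_succ _ _
  have hq' : t ^ (2 * m + 1 + 1) = p * t := pow_succ _ _
  rw [hq] at hlow hup
  rw [hq', Real.norm_eq_abs, Real.norm_of_nonneg (by positivity)]
  have hcp : c * p ≤ 1 := by nlinarith
  have hg : 1 / 2 ≤ 1 - c / 2 * p := by linarith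
  have hpp : p * p ≤ p * t := by gcongr
  have hprod : |(N t - (1 - c / 2 * p)) * (N t + (1 - c / 2 * p))| ≤ (K + c ^ 2) * (p * t) := by
    have e : (N t - (1 - c / 2 * p)) * (N t + (1 - c / 2 * p))
      = N t ^ 2 - 1 + c * p - c ^ 2 / 4 * (p * p) := by ring
    rw [e, abs_le]
    have hc2 : 0 ≤ c ^ 2 := sq_nonneg c
    have h1 : c ^ 2 * (p * p) ≤ c ^ 2 * (p * t) := by gcongr
    have h2 : 0 ≤ c ^ 2 * (p * p) := by positivity
    constructor <;> nlinarith
  rw [abs_mul, abs_of_nonneg (show 0 ≤ N t + (1 - c / 2 * p) by linarith)] at hprod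
  have := abs_nonneg (N t - (1 - c / 2 * p))
  nlinarith

/-- The exponent in an expansion `1 - c t ^ a + O(t ^ (a + 1))` with `c > 0` is unique. -/
lemma exponent_unique {f : ℝ → ℝ} {a b : ℕ} {c d : ℝ} (hc : 0 < c) (hd : 0 < d)
    (ha : (fun t : ℝ => f t - (1 - c * t ^ a)) =O[𝓝[>] 0] (fun t : ℝ => t ^ (a + 1)))
    (hb : (fun t : ℝ => f t - (1 - d * t ^ b)) =O[𝓝[>] 0] (fun t : ℝ => t ^ (b + 1))) :
    a = b := by
  by_contra hab
  wlog hlt : a < b generalizing a b c d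
  · exact this hd hc hb ha (Ne.symm hab) (by omega)
  obtain ⟨K, hK, h1⟩ := ha.exists_pos
  obtain ⟨L, hL, h2⟩ := hb.exists_pos
  rw [Asymptotics.IsBigOWith] at h1 h2
  -- With `a < b`, subtracting the expansions gives `c * t ^ a ≤ (K + L + d) * t ^ (a + 1)`; this
  -- radius makes that false.
  have hI : Ioo (0 : ℝ) (min 1 (c / (K + L + d))) ∈ 𝓝[>] (0 : ℝ) := Ioo_mem_nhdsGT (by positivity)
  obtain ⟨t, ⟨h1, h2⟩, ht0, ht⟩ := ((h1.and h2).and hI).exists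
  have ht1 := ht.trans_le (min_le_left _ _)
  have ht2 := ht.trans_le (min_le_right _ _)
  rw [lt_div_iff₀ (by positivity)] at ht2
  rw [Real.norm_eq_abs, Real.norm_of_nonneg (by positivity)] at h1 h2
  have h3 := (abs_le.1 h1).2
  have h4 := (abs_le.1 h2).1
  have e1 : t ^ b ≤ t ^ (a + 1) := pow_le_pow_of_le_one ht0.le ht1.le hlt
  have e2 : t ^ (b + 1) ≤ t ^ (a + 1) := pow_le_pow_of_le_one ht0.le ht1.le (by omega)
  have e3 : t ^ (a + 1) = t ^ a * t := pow_succ _ _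
  have h5 : c * t ^ a ≤ (K + L + d) * t ^ (a + 1) := by
    have : L * t ^ (b + 1) ≤ L * t ^ (a + 1) := by gcongr
    have : d * t ^ b ≤ d * t ^ (a + 1) := by gcongr
    linarith
  have h6 : 0 < t ^ a := by positivity
  rw [e3] at h5
  nlinarith

end Contraction

open StairIdx

/-! ### Skew-Hermitian and dissipative parts -/

section DissipativePart

variable {ι κ : Type}

lemma skewPart_sub_dissPart (A : Matrix ι ι ℂ) : skewPart A - dissPart A = A := by
  ext i j
  simp [skewPart, dissPart, hermPart]
  ring

lemma skewPart_conjTranspose (A : Matrix ι ι ℂ) : (skewPart A)ᴴ = -skewPart A := by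
  ext i j
  simp [skewPart]
  ring

lemma dissPart_conjTranspose (A : Matrix ι ι ℂ) : (dissPart A)ᴴ = dissPart A := by
  ext i j
  simp [dissPart, hermPart]
  ring

lemma dissPart_congr [Fintype ι] (A : Matrix ι ι ℂ) (T : Matrix ι κ ℂ) :
    dissPart (Tᴴ * A * T) = Tᴴ * dissPart A * T := by
  simp [dissPart, hermPart, conjTranspose_mul, Matrix.mul_assoc, Matrix.mul_add, Matrix.add_mul]

end DissipativePart

/-! ### Products and vectors in the five-block partition -/

section BlockProducts

variable {n₁ n₂ n₃ n₅ : ℕ} {ι κ : Type}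

lemma submatrix_stair_mul (M : Matrix (StairIdx n₁ n₂ n₃ n₅) (StairIdx n₁ n₂ n₃ n₅) ℂ)
    (Y : Matrix (StairIdx n₁ n₂ n₃ n₅) κ ℂ) (f : ι → StairIdx n₁ n₂ n₃ n₅) :
    (M * Y).submatrix f id = M.submatrix f in₁ * Y.submatrix in₁ id
      + M.submatrix f in₂ * Y.submatrix in₂ id + M.submatrix f in₃ * Y.submatrix in₃ id
      + M.submatrix f in₄ * Y.submatrix in₄ id + M.submatrix f in₅ * Y.submatrix in₅ id := by
  ext i j
  simp [Matrix.mul_apply, Fintype.sum_sum_type, in₁, in₂, in₃, in₄, in₅, add_assoc]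

lemma stair_mulVec_comp (M : Matrix (StairIdx n₁ n₂ n₃ n₅) (StairIdx n₁ n₂ n₃ n₅) ℂ)
    (y : StairIdx n₁ n₂ n₃ n₅ → ℂ) (f : ι → StairIdx n₁ n₂ n₃ n₅) :
    (M *ᵥ y) ∘ f = M.submatrix f in₁ *ᵥ (y ∘ in₁) + M.submatrix f in₂ *ᵥ (y ∘ in₂)
      + M.submatrix f in₃ *ᵥ (y ∘ in₃) + M.submatrix f in₄ *ᵥ (y ∘ in₄)
      + M.submatrix f in₅ *ᵥ (y ∘ in₅) := by
  ext i
  simp [Matrix.mulVec, dotProduct, Fintype.sum_sum_type, in₁, in₂, in₃, in₄, in₅, add_assoc]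

lemma stair_dotProduct (x y : StairIdx n₁ n₂ n₃ n₅ → ℂ) :
    x ⬝ᵥ y = (x ∘ in₁) ⬝ᵥ (y ∘ in₁) + (x ∘ in₂) ⬝ᵥ (y ∘ in₂) + (x ∘ in₃) ⬝ᵥ (y ∘ in₃)
      + (x ∘ in₄) ⬝ᵥ (y ∘ in₄) + (x ∘ in₅) ⬝ᵥ (y ∘ in₅) := by
  simp [dotProduct, Fintype.sum_sum_type, in₁, in₂, in₃, in₄, in₅, add_assoc]

lemma stair_ext {Y Z : Matrix (StairIdx n₁ n₂ n₃ n₅) κ ℂ}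
    (h₁ : Y.submatrix in₁ id = Z.submatrix in₁ id) (h₂ : Y.submatrix in₂ id = Z.submatrix in₂ id)
    (h₃ : Y.submatrix in₃ id = Z.submatrix in₃ id) (h₄ : Y.submatrix in₄ id = Z.submatrix in₄ id)
    (h₅ : Y.submatrix in₅ id = Z.submatrix in₅ id) : Y = Z := by
  ext (i | i | i | i | i) j
  exacts [congrFun₂ h₁ i j, congrFun₂ h₂ i j, congrFun₂ h₃ i j, congrFun₂ h₄ i j,
    congrFun₂ h₅ i j]

end BlockProducts

/-! ### Reduction of the DAE to the underlying ODE -/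

namespace StaircaseForm

variable {n : ℕ} {E A : Matrix (Fin n) (Fin n) ℂ} (F : StaircaseForm E A)

lemma E₂₂_posDef : F.E₂₂.PosDef :=
  F.E_posDef.submatrix (e := Sum.inr) Sum.inr_injective

lemma sqrt_mul_sqrt : CFC.sqrt F.E₂₂ * CFC.sqrt F.E₂₂ = F.E₂₂ :=
  CFC.sqrt_mul_sqrt_self _ F.E₂₂_posDef.posSemidef.nonneg

lemma sqrt_conjTranspose : (CFC.sqrt F.E₂₂)ᴴ = CFC.sqrt F.E₂₂ :=
  (Matrix.nonneg_iff_posSemidef.1 (CFC.sqrt_nonneg F.E₂₂)).isHermitian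

lemma isUnit_det_sqrt : IsUnit (CFC.sqrt F.E₂₂).det := by
  have h := (Matrix.isUnit_iff_isUnit_det _).1 F.E₂₂_posDef.isUnit
  rw [← F.sqrt_mul_sqrt, det_mul] at h
  exact isUnit_of_mul_isUnit_left h

lemma A_apply (p q) : (F.P * A * F.Pᴴ) p q
    = (F.P * skewPart A * F.Pᴴ) p q - (F.P * dissPart A * F.Pᴴ) p q := by
  rw [← Matrix.sub_apply, ← Matrix.sub_mul, ← Matrix.mul_sub, skewPart_sub_dissPart]

/-- Together with `R_swap` and `E_swap`, this transfers the zero block rows in the definition of a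
staircase form to block columns. -/
lemma J_swap (p q) : (F.P * skewPart A * F.Pᴴ) p q
    = -star ((F.P * skewPart A * F.Pᴴ) q p) := by
  rw [← conjTranspose_apply, ← Matrix.neg_apply]
  rw [Matrix.conjTranspose_mul, Matrix.conjTranspose_mul, conjTranspose_conjTranspose, skewPart_conjTranspose,
    Matrix.neg_mul, Matrix.mul_neg, neg_neg, Matrix.mul_assoc]

lemma R_swap (p q) : (F.P * dissPart A * F.Pᴴ) p q
    = star ((F.P * dissPart A * F.Pᴴ) q p) := by
  rw [← conjTranspose_apply]
  rw [Matrix.conjTranspose_mul, Matrix.conjTranspose_mul, conjTranspose_conjTranspose, dissPart_conjTranspose,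
    Matrix.mul_assoc]

lemma E_swap (hE : E.IsHermitian) (p q) : (F.P * E * F.Pᴴ) p q
    = star ((F.P * E * F.Pᴴ) q p) := by
  rw [← conjTranspose_apply]
  rw [Matrix.conjTranspose_mul, Matrix.conjTranspose_mul, conjTranspose_conjTranspose, hE.eq,
    Matrix.mul_assoc]

lemma A_row₅ (i q) : (F.P * A * F.Pᴴ) (in₅ i) q = 0 := by
  rw [A_apply, F.J_row₅, F.R_row₅, sub_zero]

lemma A_col₅ (q i) : (F.P * A * F.Pᴴ) q (in₅ i) = 0 := by
  rw [A_apply, J_swap, R_swap, F.J_row₅, F.R_row₅]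
  simp

lemma A_block₄₂ : (F.P * A * F.Pᴴ).submatrix in₄ in₂ = 0 := by
  ext i j
  rw [submatrix_apply, A_apply, F.J_block₄₂, F.R_row₄, sub_zero, Matrix.zero_apply]

lemma A_block₄₃ : (F.P * A * F.Pᴴ).submatrix in₄ in₃ = 0 := by
  ext i j
  rw [submatrix_apply, A_apply, F.J_block₄₃, F.R_row₄, sub_zero, Matrix.zero_apply]

lemma A_block₄₄ : (F.P * A * F.Pᴴ).submatrix in₄ in₄ = 0 := by
  ext i j
  rw [submatrix_apply, A_apply, F.J_block₄₄, F.R_row₄, sub_zero, Matrix.zero_apply]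

lemma A_block₂₄ : (F.P * A * F.Pᴴ).submatrix in₂ in₄ = 0 := by
  ext i j
  rw [submatrix_apply, A_apply, J_swap, R_swap, F.J_block₄₂, F.R_row₄]
  simp

lemma A_block₃₄ : (F.P * A * F.Pᴴ).submatrix in₃ in₄ = 0 := by
  ext i j
  rw [submatrix_apply, A_apply, J_swap, R_swap, F.J_block₄₃, F.R_row₄]
  simp

lemma A_block₄₁ : (F.P * A * F.Pᴴ).submatrix in₄ in₁
    = (F.P * skewPart A * F.Pᴴ).submatrix in₄ in₁ := by
  ext i j
  rw [submatrix_apply, A_apply, F.R_row₄, sub_zero, submatrix_apply]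

lemma A_block₁₄ : (F.P * A * F.Pᴴ).submatrix in₁ in₄
    = -((F.P * skewPart A * F.Pᴴ).submatrix in₄ in₁)ᴴ := by
  ext i j
  rw [submatrix_apply, A_apply, J_swap, R_swap, F.R_row₄, star_zero, sub_zero]
  rfl

lemma A_block_row₅ {κ : Type} (f : κ → StairIdx F.n₁ F.n₂ F.n₃ F.n₅) :
    (F.P * A * F.Pᴴ).submatrix in₅ f = 0 := by
  ext i j
  exact F.A_row₅ _ _

lemma A_block_col₅ {κ : Type} (f : κ → StairIdx F.n₁ F.n₂ F.n₃ F.n₅) :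
    (F.P * A * F.Pᴴ).submatrix f in₅ = 0 := by
  ext i j
  exact F.A_col₅ _ _

lemma E_block_row₃ {κ : Type} (f : κ → StairIdx F.n₁ F.n₂ F.n₃ F.n₅) :
    (F.P * E * F.Pᴴ).submatrix in₃ f = 0 := by
  ext i j
  exact F.E_row₃ _ _

lemma E_block_row₄ {κ : Type} (f : κ → StairIdx F.n₁ F.n₂ F.n₃ F.n₅) :
    (F.P * E * F.Pᴴ).submatrix in₄ f = 0 := by
  ext i j
  exact F.E_row₄ _ _

lemma E_block_row₅ {κ : Type} (f : κ → StairIdx F.n₁ F.n₂ F.n₃ F.n₅) :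
    (F.P * E * F.Pᴴ).submatrix in₅ f = 0 := by
  ext i j
  exact F.E_row₅ _ _

lemma E_block_col₃ (hE : E.IsHermitian) {κ : Type} (f : κ → StairIdx F.n₁ F.n₂ F.n₃ F.n₅) :
    (F.P * E * F.Pᴴ).submatrix f in₃ = 0 := by
  ext i j
  rw [submatrix_apply, F.E_swap hE, F.E_row₃, star_zero, Matrix.zero_apply]

lemma E_block_col₄ (hE : E.IsHermitian) {κ : Type} (f : κ → StairIdx F.n₁ F.n₂ F.n₃ F.n₅) :
    (F.P * E * F.Pᴴ).submatrix f in₄ = 0 := by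
  ext i j
  rw [submatrix_apply, F.E_swap hE, F.E_row₄, star_zero, Matrix.zero_apply]

lemma E_block_col₅ (hE : E.IsHermitian) {κ : Type} (f : κ → StairIdx F.n₁ F.n₂ F.n₃ F.n₅) :
    (F.P * E * F.Pᴴ).submatrix f in₅ = 0 := by
  ext i j
  rw [submatrix_apply, F.E_swap hE, F.E_row₅, star_zero, Matrix.zero_apply]

/-- The solutions of the underlying ODE embed linearly into those of the DAE. -/
lemma exists_lift (hE : E.IsHermitian) : ∃ T : Matrix (Fin n) (Fin F.n₂) ℂ,
    A * T = E * T * F.systemMatrix ∧ Tᴴ * E * T = 1 := by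
  set M := F.P * A * F.Pᴴ with hM
  set G := F.P * E * F.Pᴴ with hG
  set S := CFC.sqrt F.E₂₂ with hS
  set B := F.systemMatrix with hB
  have hSu : IsUnit S.det := F.isUnit_det_sqrt
  have h33 : IsUnit (M.submatrix in₃ in₃).det :=
    (Matrix.isUnit_iff_isUnit_det _).1 F.isUnit_A₃₃
  have h14 : IsUnit (M.submatrix in₁ in₄).det := by
    have := (Matrix.isUnit_iff_isUnit_det _).1 F.isUnit_J₄₁
    rw [hM, F.A_block₁₄, det_neg, det_conjTranspose]
    exact ((isUnit_one.neg).pow _).mul this.star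
  -- `Y₃` solves the third block row of `M * Y = G * Y * B`, and `Y₄` the first, through the
  -- invertible `A₁₄ = -J₄₁ᴴ`. The second row is the definition of the system matrix; the last two
  -- are trivial.
  let Y₃ := -((M.submatrix in₃ in₃)⁻¹ * M.submatrix in₃ in₂ * S⁻¹)
  let Y₄ := (M.submatrix in₁ in₄)⁻¹ * (G.submatrix in₁ in₂ * S⁻¹ * B
    - M.submatrix in₁ in₂ * S⁻¹ - M.submatrix in₁ in₃ * Y₃)
  let Y : Matrix (StairIdx F.n₁ F.n₂ F.n₃ F.n₅) (Fin F.n₂) ℂ :=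
    fromRows 0 (fromRows S⁻¹ (fromRows Y₃ (fromRows Y₄ 0)))
  have y₁ : Y.submatrix in₁ id = 0 := rfl
  have y₂ : Y.submatrix in₂ id = S⁻¹ := rfl
  have y₃ : Y.submatrix in₃ id = Y₃ := rfl
  have y₄ : Y.submatrix in₄ id = Y₄ := rfl
  have y₅ : Y.submatrix in₅ id = 0 := rfl
  have hGY : ∀ {κ : Type} (f : κ → StairIdx F.n₁ F.n₂ F.n₃ F.n₅),
      (G * Y).submatrix f id = G.submatrix f in₂ * S⁻¹ := fun f => by
    rw [submatrix_stair_mul, y₁, y₂, y₅, F.E_block_col₃ hE, F.E_block_col₄ hE]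
    simp
  have hGYB : ∀ {κ : Type} (f : κ → StairIdx F.n₁ F.n₂ F.n₃ F.n₅),
      (G * Y * B).submatrix f id = G.submatrix f in₂ * S⁻¹ * B := fun f => by
    rw [← hGY f]
    rfl
  have hMY : M * Y = G * Y * B := by
    apply stair_ext
    · rw [submatrix_stair_mul, hGYB, y₁, y₂, y₃, y₄, y₅]
      simp only [Y₄]
      rw [Matrix.mul_nonsing_inv_cancel_left _ _ h14]
      simp
    · rw [submatrix_stair_mul, hGYB, y₁, y₂, y₃, y₄, y₅, F.A_block₂₄]
      have e1 : G.submatrix in₂ in₂ * S⁻¹ = S := by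
        change F.E₂₂ * S⁻¹ = S
        rw [← F.sqrt_mul_sqrt, Matrix.mul_nonsing_inv_cancel_right _ _ hSu]
      rw [e1, hB, systemMatrix, Matrix.mul_assoc, Matrix.mul_nonsing_inv_cancel_left _ _ hSu, Ahat₂₂]
      simp only [Y₃, Matrix.add_mul, Matrix.neg_mul, Matrix.mul_neg, Matrix.mul_assoc, Matrix.mul_zero,
        Matrix.zero_mul, add_zero, zero_add, sub_eq_add_neg, hM, hS]
    · rw [submatrix_stair_mul, hGYB, y₁, y₂, y₃, y₄, y₅, F.A_block₃₄, F.E_block_row₃]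
      simp only [Y₃]
      rw [Matrix.mul_neg, Matrix.mul_assoc _⁻¹, Matrix.mul_nonsing_inv_cancel_left _ _ h33]
      simp
    · rw [submatrix_stair_mul, hGYB, y₁, y₅, F.A_block₄₂, F.A_block₄₃, F.A_block₄₄, F.E_block_row₄]
      simp
    · rw [submatrix_stair_mul, hGYB, F.A_block_row₅, F.A_block_row₅, F.A_block_row₅,
        F.A_block_row₅, F.A_block_row₅, F.E_block_row₅]
      simp
  have hPP := F.conjTranspose_mul
  have key : ∀ X : Matrix (Fin n) (Fin n) ℂ, X * (F.Pᴴ * Y) = F.Pᴴ * (F.P * X * F.Pᴴ * Y) :=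
    fun X => by simp only [← Matrix.mul_assoc, hPP, Matrix.one_mul]
  refine ⟨F.Pᴴ * Y, ?_, ?_⟩
  · rw [key A, key E, ← hM, ← hG, hMY, Matrix.mul_assoc F.Pᴴ]
  · have e : (F.Pᴴ * Y)ᴴ * E * (F.Pᴴ * Y) = Yᴴ * (G * Y) := by
      rw [Matrix.conjTranspose_mul, conjTranspose_conjTranspose, hG]
      simp only [Matrix.mul_assoc]
    rw [e]
    ext i j
    have hrow : ∀ (q : Fin F.n₂), (G * Y) (in₂ q) j = S q j := fun q => by
      have := congrFun₂ (hGY in₂) q j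
      refine this.trans ?_
      change (F.E₂₂ * S⁻¹) q j = S q j
      rw [← F.sqrt_mul_sqrt, Matrix.mul_nonsing_inv_cancel_right _ _ hSu]
    have hr3 : ∀ q, (G * Y) (in₃ q) j = 0 := fun q => by
      refine (congrFun₂ (hGY in₃) q j).trans ?_
      rw [F.E_block_row₃, Matrix.zero_mul, Matrix.zero_apply]
    have hr4 : ∀ q, (G * Y) (in₄ q) j = 0 := fun q => by
      refine (congrFun₂ (hGY in₄) q j).trans ?_
      rw [F.E_block_row₄, Matrix.zero_mul, Matrix.zero_apply]
    rw [Matrix.mul_apply', stair_dotProduct]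
    have z1 : (fun k => Yᴴ i k) ∘ in₁ = 0 := by
      ext k; exact star_zero ℂ
    have z5 : (fun k => Yᴴ i k) ∘ in₅ = 0 := by
      ext k; exact star_zero ℂ
    have z2 : (fun k => Yᴴ i k) ∘ in₂ = fun k => S⁻¹ i k := by
      ext k
      change (S⁻¹)ᴴ i k = _
      rw [conjTranspose_nonsing_inv, F.sqrt_conjTranspose]
    have w2 : (fun k => (G * Y) k j) ∘ in₂ = fun k => S k j := funext hrow
    have w3 : (fun k => (G * Y) k j) ∘ in₃ = 0 := funext hr3
    have w4 : (fun k => (G * Y) k j) ∘ in₄ = 0 := funext hr4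
    rw [z1, z5, z2, w2, w3, w4, zero_dotProduct, zero_dotProduct, dotProduct_zero, dotProduct_zero,
      ← Matrix.nonsing_inv_mul S hSu, Matrix.mul_apply']
    simp

/-- The solutions of the DAE project linearly to those of the underlying ODE. -/
lemma exists_proj (hE : E.IsHermitian) : ∃ (L : Matrix (Fin F.n₁) (Fin n) ℂ)
    (Z : Matrix (Fin F.n₂) (Fin n) ℂ), ∀ x x' : Fin n → ℂ, E *ᵥ x' = A *ᵥ x →
      L *ᵥ x = 0 ∧ (L *ᵥ x' = 0 → Z *ᵥ x' = F.systemMatrix *ᵥ Z *ᵥ x) ∧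
      star x ⬝ᵥ E *ᵥ x = star (Z *ᵥ x) ⬝ᵥ Z *ᵥ x := by
  set M := F.P * A * F.Pᴴ with hM
  set G := F.P * E * F.Pᴴ with hG
  set S := CFC.sqrt F.E₂₂ with hS
  have hSu : IsUnit S.det := F.isUnit_det_sqrt
  have h33 : IsUnit (M.submatrix in₃ in₃).det :=
    (Matrix.isUnit_iff_isUnit_det _).1 F.isUnit_A₃₃
  -- `L` reads off `y₁` and `Z` gives `E₂₂^{1/2} y₂`. That `y₁` vanishes follows from the algebraic
  -- equation at one instant; that its derivative vanishes does not, and is left as a premise.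
  refine ⟨F.P.submatrix in₁ id, S * F.P.submatrix in₂ id, fun x x' h => ?_⟩
  set y := F.P *ᵥ x with hy
  set y' := F.P *ᵥ x' with hy'
  have hx : F.Pᴴ *ᵥ y = x := by rw [hy, mulVec_mulVec, F.conjTranspose_mul, one_mulVec]
  have hx' : F.Pᴴ *ᵥ y' = x' := by rw [hy', mulVec_mulVec, F.conjTranspose_mul, one_mulVec]
  have e1 : F.P.submatrix in₁ id *ᵥ x = y ∘ in₁ := rfl
  have e1' : F.P.submatrix in₁ id *ᵥ x' = y' ∘ in₁ := rfl
  have e2 : (S * F.P.submatrix in₂ id) *ᵥ x = S *ᵥ (y ∘ in₂) := by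
    rw [← mulVec_mulVec]
    rfl
  have e2' : (S * F.P.submatrix in₂ id) *ᵥ x' = S *ᵥ (y' ∘ in₂) := by
    rw [← mulVec_mulVec]
    rfl
  have hGM : G *ᵥ y' = M *ᵥ y := by
    rw [hG, hM, ← mulVec_mulVec, hx', ← mulVec_mulVec, ← mulVec_mulVec, h, hx, mulVec_mulVec]
  have hrow : ∀ {κ : Type} (f : κ → StairIdx F.n₁ F.n₂ F.n₃ F.n₅),
      G.submatrix f in₁ *ᵥ (y' ∘ in₁) + G.submatrix f in₂ *ᵥ (y' ∘ in₂)
        = M.submatrix f in₁ *ᵥ (y ∘ in₁) + M.submatrix f in₂ *ᵥ (y ∘ in₂)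
      + M.submatrix f in₃ *ᵥ (y ∘ in₃) + M.submatrix f in₄ *ᵥ (y ∘ in₄) := fun f => by
    have := congrArg (fun v => v ∘ f) hGM
    simp only [stair_mulVec_comp] at this
    rw [F.E_block_col₃ hE, F.E_block_col₄ hE, F.E_block_col₅ hE, F.A_block_col₅] at this
    simpa using this
  have hy₁ : y ∘ in₁ = 0 := by
    have h4 := hrow in₄
    rw [F.A_block₄₂, F.A_block₄₃, F.A_block₄₄, F.E_block_row₄, F.E_block_row₄, F.A_block₄₁] at h4
    simp only [zero_mulVec, add_zero] at h4
    by_contra hne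
    exact ((Matrix.isUnit_iff_isUnit_det _).1 F.isUnit_J₄₁).ne_zero
      (exists_mulVec_eq_zero_iff.1 ⟨_, hne, h4.symm⟩)
  rw [e1, e1', e2, e2']
  refine ⟨hy₁, fun hy₁' => ?_, ?_⟩
  · have h2 := hrow in₂
    have h3 := hrow in₃
    rw [hy₁, hy₁', F.A_block₂₄] at h2
    rw [hy₁, F.A_block₃₄, F.E_block_row₃, F.E_block_row₃] at h3
    simp only [mulVec_zero, zero_mulVec, add_zero, zero_add] at h2 h3
    have hy₃ : y ∘ in₃ = -((M.submatrix in₃ in₃)⁻¹ *ᵥ M.submatrix in₃ in₂ *ᵥ (y ∘ in₂)) := by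
      rw [eq_neg_of_add_eq_zero_left h3.symm, mulVec_neg, neg_neg, mulVec_mulVec,
        nonsing_inv_mul _ h33, one_mulVec]
    have hd : F.E₂₂ *ᵥ (y' ∘ in₂) = F.Ahat₂₂ *ᵥ (y ∘ in₂) := by
      refine h2.trans ?_
      rw [hy₃, Ahat₂₂, sub_mulVec, mulVec_neg, ← sub_eq_add_neg, mulVec_mulVec, mulVec_mulVec,
        Matrix.mul_assoc]
    rw [← F.sqrt_mul_sqrt, ← mulVec_mulVec] at hd
    rw [systemMatrix, mulVec_mulVec, Matrix.mul_assoc, nonsing_inv_mul _ hSu, Matrix.mul_one,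
      ← mulVec_mulVec, ← hd, mulVec_mulVec, nonsing_inv_mul _ hSu, one_mulVec]
  · have hq : star x ⬝ᵥ E *ᵥ x = star y ⬝ᵥ G *ᵥ y := by
      conv_lhs => rw [← hx]
      rw [star_mulVec, conjTranspose_conjTranspose, hG, ← dotProduct_mulVec, mulVec_mulVec,
        mulVec_mulVec, Matrix.mul_assoc]
    have hG2 : ∀ {κ : Type} (f : κ → StairIdx F.n₁ F.n₂ F.n₃ F.n₅),
        (G *ᵥ y) ∘ f = G.submatrix f in₂ *ᵥ (y ∘ in₂) := fun f => by
      rw [stair_mulVec_comp, hy₁, F.E_block_col₃ hE, F.E_block_col₄ hE, F.E_block_col₅ hE]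
      simp
    have hsy : star y ∘ in₁ = 0 := by
      ext i
      have := congrFun hy₁ i
      simp only [Function.comp_apply, Pi.zero_apply] at this
      simp [this]
    rw [hq, stair_dotProduct, hsy, hG2 in₂, hG2 in₃, hG2 in₄, hG2 in₅, F.E_block_row₃,
      F.E_block_row₄, F.E_block_row₅, zero_dotProduct]
    simp only [zero_mulVec, dotProduct_zero, zero_add, add_zero]
    rw [star_mulVec S, F.sqrt_conjTranspose, ← dotProduct_mulVec, mulVec_mulVec, F.sqrt_mul_sqrt]
    rfl

end StaircaseForm

/-! ### HC-index and observability kernels -/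

section HypocoercivityIndex

variable {k : ℕ}

lemma re_star_dotProduct_self (x : EuclideanSpace ℂ (Fin k)) :
    star x.ofLp ⬝ᵥ x.ofLp = ((‖x‖ ^ 2 : ℝ) : ℂ) := by
  rw [dotProduct_comm, ← EuclideanSpace.inner_eq_star_dotProduct, inner_self_eq_norm_sq_to_K]
  simp

/-- A Cholesky-type factor `S` of the dissipative part, `R = Sᴴ S`. -/
lemma exists_dissPart_factor {B : Matrix (Fin k) (Fin k) ℂ} (hB : IsSemiDissipative B) :
    ∃ S : Matrix (Fin k) (Fin k) ℂ, dissPart B = Sᴴ * S := by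
  have h : 0 ≤ dissPart B := Matrix.nonneg_iff_posSemidef.2 hB
  refine ⟨CFC.sqrt (dissPart B), ?_⟩
  rw [(Matrix.nonneg_iff_posSemidef.1 (CFC.sqrt_nonneg (dissPart B))).isHermitian.eq,
    CFC.sqrt_mul_sqrt_self _ h]

lemma re_inner_of_factor {B S : Matrix (Fin k) (Fin k) ℂ} (hS : dissPart B = Sᴴ * S)
    (x : EuclideanSpace ℂ (Fin k)) :
    (inner ℂ x (toEuclideanCLM (𝕜 := ℂ) B x)).re = -‖toEuclideanCLM (𝕜 := ℂ) S x‖ ^ 2 := by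
  have h1 : (inner ℂ x (toEuclideanCLM (𝕜 := ℂ) (dissPart B) x))
      = ((‖toEuclideanCLM (𝕜 := ℂ) S x‖ ^ 2 : ℝ) : ℂ) := by
    rw [← re_star_dotProduct_self, EuclideanSpace.inner_eq_star_dotProduct, ofLp_toEuclideanCLM,
      ofLp_toEuclideanCLM, hS, dotProduct_comm, ← mulVec_mulVec, dotProduct_mulVec,
      star_mulVec]
  have h2 : dissPart B = -((1 / 2 : ℂ) • (B + Bᴴ)) := rfl
  rw [h2, map_neg, map_smul, map_add, ← star_eq_conjTranspose, map_star,
    ContinuousLinearMap.star_eq_adjoint] at h1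
  have h3 := congrArg Complex.re h1
  simp only [_root_.neg_apply, _root_.smul_apply, _root_.add_apply, inner_neg_right,
    inner_smul_right, inner_add_right, ContinuousLinearMap.adjoint_inner_right] at h3
  have h4 : (inner ℂ (toEuclideanCLM (𝕜 := ℂ) B x) x).re
      = (inner ℂ x (toEuclideanCLM (𝕜 := ℂ) B x)).re := by
    rw [← inner_conj_symm, Complex.conj_re]
  have h5 : (1 / 2 : ℂ) = ((1 / 2 : ℝ) : ℂ) := by norm_num
  rw [Complex.ofReal_re, h5, Complex.neg_re, Complex.re_ofReal_mul, Complex.add_re, h4] at h3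
  linarith

/-- Where `S v = 0`, also `R v = 0` and hence `J v = B v`; so, as long as `S` kills the successive
iterates, those of `J` and of `B` agree. This lets Kalman sums, written with `J`, be read through
the dynamics of `B`. -/
lemma skewPart_pow_mulVec {B S : Matrix (Fin k) (Fin k) ℂ} (hS : dissPart B = Sᴴ * S)
    {x : Fin k → ℂ} : ∀ j : ℕ,
    ((∀ i < j, S *ᵥ (skewPart B ^ i *ᵥ x) = 0) ∨ ∀ i < j, S *ᵥ (B ^ i *ᵥ x) = 0) →
      ∀ i ≤ j, skewPart B ^ i *ᵥ x = B ^ i *ᵥ x := by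
  have step : ∀ v, S *ᵥ v = 0 → skewPart B *ᵥ v = B *ᵥ v := fun v hv => by
    conv_rhs => rw [← skewPart_sub_dissPart B]
    rw [sub_mulVec, hS, ← mulVec_mulVec, hv, mulVec_zero, sub_zero]
  intro j h i
  induction i with
  | zero => intro; simp
  | succ i ih =>
    intro hi
    have ih' := ih (by omega)
    rw [pow_succ', pow_succ', ← mulVec_mulVec, ← mulVec_mulVec, ih']
    refine step _ ?_
    rcases h with h | h
    · rw [← ih']
      exact h i hi
    · exact h i hi

lemma skewPart_kernel_iff {B S : Matrix (Fin k) (Fin k) ℂ} (hS : dissPart B = Sᴴ * S)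
    (x : Fin k → ℂ) (j : ℕ) : (∀ i < j, S *ᵥ (skewPart B ^ i *ᵥ x) = 0)
      ↔ ∀ i < j, S *ᵥ (B ^ i *ᵥ x) = 0 := by
  constructor
  · intro h i hi
    rw [← skewPart_pow_mulVec hS j (Or.inl h) i hi.le]
    exact h i hi
  · intro h i hi
    rw [skewPart_pow_mulVec hS j (Or.inr h) i hi.le]
    exact h i hi

lemma mem_obsKer_toEuclideanCLM {B S : Matrix (Fin k) (Fin k) ℂ} {j : ℕ}
    {x : EuclideanSpace ℂ (Fin k)} :
    x ∈ obsKer (toEuclideanCLM (𝕜 := ℂ) B) (toEuclideanCLM (𝕜 := ℂ) S) j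
      ↔ ∀ i < j, S *ᵥ (B ^ i *ᵥ x.ofLp) = 0 := by
  rw [mem_obsKer]
  refine forall₂_congr fun i _ => ?_
  rw [← map_pow, ← WithLp.ofLp_eq_zero (p := 2), ofLp_toEuclideanCLM, ofLp_toEuclideanCLM]

/-- The sum has `Jʲ` on the left and `(Jᴴ)ʲ` on the right; as `Jᴴ = -J`, exchanging them produces
two signs `(-1)ʲ` that cancel. -/
lemma dotProduct_kalmanSum {B S : Matrix (Fin k) (Fin k) ℂ} (hS : dissPart B = Sᴴ * S) (m : ℕ)
    (x : Fin k → ℂ) : star x ⬝ᵥ kalmanSum B m *ᵥ x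
      = ∑ j ∈ Finset.range (m + 1),
        star (S *ᵥ (skewPart B ^ j *ᵥ x)) ⬝ᵥ S *ᵥ (skewPart B ^ j *ᵥ x) := by
  rw [kalmanSum, sum_mulVec, dotProduct_sum]
  refine Finset.sum_congr rfl fun j _ => ?_
  have h1 : (skewPart B)ᴴ ^ j *ᵥ x = (-1 : ℂ) ^ j • (skewPart B ^ j *ᵥ x) := by
    rw [skewPart_conjTranspose, ← neg_one_smul ℂ (skewPart B), smul_pow, smul_mulVec]
  have h2 : (skewPart B ^ j)ᴴ = (-1 : ℂ) ^ j • skewPart B ^ j := by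
    rw [conjTranspose_pow, skewPart_conjTranspose, ← neg_one_smul ℂ (skewPart B), smul_pow]
  have h3 : star x ⬝ᵥ (skewPart B ^ j * dissPart B * (skewPart B)ᴴ ^ j) *ᵥ x
      = star x ⬝ᵥ ((skewPart B ^ j)ᴴ * dissPart B) *ᵥ (skewPart B ^ j *ᵥ x) := by
    rw [← mulVec_mulVec, h1, h2, mulVec_smul, ← smul_mulVec, Matrix.smul_mul]
  rw [h3, hS, star_mulVec, star_mulVec, ← dotProduct_mulVec, ← dotProduct_mulVec]
  simp only [mulVec_mulVec, Matrix.mul_assoc]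

lemma kalmanSum_isHermitian (B : Matrix (Fin k) (Fin k) ℂ) (m : ℕ) :
    (kalmanSum B m).IsHermitian := by
  rw [Matrix.IsHermitian, kalmanSum, conjTranspose_sum]
  refine Finset.sum_congr rfl fun j _ => ?_
  rw [conjTranspose_mul, conjTranspose_mul, conjTranspose_pow, conjTranspose_conjTranspose,
    dissPart_conjTranspose, conjTranspose_pow, Matrix.mul_assoc]

lemma kalmanSum_posDef_iff {B S : Matrix (Fin k) (Fin k) ℂ} (hS : dissPart B = Sᴴ * S) (m : ℕ) :
    (kalmanSum B m).PosDef
      ↔ obsKer (toEuclideanCLM (𝕜 := ℂ) B) (toEuclideanCLM (𝕜 := ℂ) S) (m + 1) = ⊥ := by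
  have hnn : ∀ v : Fin k → ℂ, 0 ≤ star v ⬝ᵥ v := fun v => dotProduct_star_self_nonneg v
  rw [Submodule.eq_bot_iff]
  constructor
  · intro h x hx
    rw [mem_obsKer_toEuclideanCLM, ← skewPart_kernel_iff hS] at hx
    by_contra hne
    have hpos := h.dotProduct_mulVec_pos (x := x.ofLp) (by rwa [Ne, WithLp.ofLp_eq_zero])
    rw [dotProduct_kalmanSum hS, Finset.sum_eq_zero] at hpos
    · exact lt_irrefl _ hpos
    · intro j hj
      rw [hx j (Finset.mem_range.1 hj), dotProduct_zero]
  · intro h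
    refine PosDef.of_dotProduct_mulVec_pos (kalmanSum_isHermitian B m) fun x hx => ?_
    rw [dotProduct_kalmanSum hS]
    refine lt_of_le_of_ne (Finset.sum_nonneg fun j _ => hnn _) fun h0 => hx ?_
    have hz := (Finset.sum_eq_zero_iff_of_nonneg fun j _ => hnn _).1 h0.symm
    have := h (WithLp.toLp 2 x) (by
      rw [mem_obsKer_toEuclideanCLM, ← skewPart_kernel_iff hS]
      exact fun i hi => dotProduct_star_self_eq_zero.1 (hz i (Finset.mem_range.2 hi)))
    simpa using this

lemma hcIndex_le {B : Matrix (Fin k) (Fin k) ℂ} {m : ℕ} (h : (kalmanSum B m).PosDef) :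
    hcIndex B ≤ m := iInf₂_le m h

lemma posDef_of_hcIndex_eq {B : Matrix (Fin k) (Fin k) ℂ} {m : ℕ} (h : hcIndex B = m) :
    (kalmanSum B m).PosDef := by
  by_contra hn
  by_cases hex : ∃ j, (kalmanSum B j).PosDef
  · classical
    let j := Nat.find hex
    have hj : hcIndex B = j := le_antisymm (hcIndex_le (Nat.find_spec hex))
      (le_iInf₂ fun i hi => by exact_mod_cast Nat.find_min' hex hi)
    have : j = m := by exact_mod_cast hj.symm.trans h
    exact hn (this ▸ Nat.find_spec hex)
  · have : hcIndex B = ⊤ := by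
      rw [hcIndex, iInf₂_eq_top]
      exact fun i hi => absurd ⟨i, hi⟩ hex
    rw [this] at h
    exact absurd h.symm (ENat.natCast_ne_top m)

/-- The second claim for `m = 0` is `⊤ ≠ ⊥`, which is where `0 < k` enters; for positive `m` it is
minimality. -/
lemma obsKer_of_hcIndex_eq {B S : Matrix (Fin k) (Fin k) ℂ} (hS : dissPart B = Sᴴ * S)
    (hk : 0 < k) {m : ℕ} (h : hcIndex B = m) :
    obsKer (toEuclideanCLM (𝕜 := ℂ) B) (toEuclideanCLM (𝕜 := ℂ) S) (m + 1) = ⊥ ∧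
      obsKer (toEuclideanCLM (𝕜 := ℂ) B) (toEuclideanCLM (𝕜 := ℂ) S) m ≠ ⊥ := by
  refine ⟨(kalmanSum_posDef_iff hS m).1 (posDef_of_hcIndex_eq h), fun hb => ?_⟩
  rcases m with _ | m
  · have : Nonempty (Fin k) := ⟨⟨0, hk⟩⟩
    rw [obsKer_zero] at hb
    exact top_ne_bot hb
  · have := hcIndex_le ((kalmanSum_posDef_iff hS m).2 hb)
    rw [h] at this
    have : m + 1 ≤ m := by exact_mod_cast this
    omega

/-- A semi-dissipative matrix without imaginary eigenvalues has finite hypocoercivity index. -/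
lemma exists_hcIndex_eq {B : Matrix (Fin k) (Fin k) ℂ} (hB : IsSemiDissipative B)
    (hev : ∀ (l : ℂ) (x : Fin k → ℂ), x ≠ 0 → B *ᵥ x = l • x → l.re < 0) :
    ∃ m : ℕ, hcIndex B = m := by
  obtain ⟨S, hS⟩ := exists_dissPart_factor hB
  set b := toEuclideanCLM (𝕜 := ℂ) B with hb
  set c := toEuclideanCLM (𝕜 := ℂ) S with hc
  -- Once the chain is stationary its limit is `b`-invariant. If nonzero, it contains an eigenvector
  -- `v` with `c v = 0`, whose eigenvalue has real part zero because `Re ⟪v, b v⟫ = -‖c v‖²`.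
  obtain ⟨N, hN⟩ := IsArtinian.monotone_stabilizes
    (⟨fun j => OrderDual.toDual (obsKer b c j), fun i j hij => obsKer_antitone b c hij⟩ :
      ℕ →o (Submodule ℂ (EuclideanSpace ℂ (Fin k)))ᵒᵈ)
  have hN' : obsKer b c N = obsKer b c (N + 1) := hN (N + 1) N.le_succ
  have hbot : obsKer b c (N + 1) = ⊥ := by
    by_contra hne
    have hinv : ∀ x ∈ obsKer b c (N + 1), b x ∈ obsKer b c (N + 1) := fun x hx => by
      rw [← hN']
      intro i hi
      have := hx (i + 1) (by omega)
      rwa [pow_succ] at this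
    have : Nontrivial (obsKer b c (N + 1)) := Submodule.nontrivial_iff_ne_bot.2 hne
    let f : Module.End ℂ (obsKer b c (N + 1)) := b.toLinearMap.restrict hinv
    obtain ⟨l, hl⟩ := Module.End.exists_eigenvalue f
    obtain ⟨v, hv⟩ := hl.exists_hasEigenvector
    have hv0 : (v : EuclideanSpace ℂ (Fin k)) ≠ 0 := fun h => hv.2 (Subtype.ext h)
    have hbv : b v = l • (v : EuclideanSpace ℂ (Fin k)) := congrArg Subtype.val hv.apply_eq_smul
    have hlt := hev l v.1.ofLp (by rwa [Ne, WithLp.ofLp_eq_zero]) (by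
      rw [← ofLp_toEuclideanCLM, ← hb, hbv, WithLp.ofLp_smul])
    have hcv : c v = 0 := by
      have := v.2 0 (Nat.succ_pos N)
      simpa using this
    have hre := re_inner_of_factor hS (v : EuclideanSpace ℂ (Fin k))
    rw [← hb, ← hc, hcv, hbv, inner_smul_right, inner_self_eq_norm_sq_to_K] at hre
    have hn : 0 < ‖(v : EuclideanSpace ℂ (Fin k))‖ ^ 2 := by
      have := norm_pos_iff.2 hv0
      positivity
    have e : (l * ((‖(v : EuclideanSpace ℂ (Fin k))‖ : ℂ)) ^ 2).re
        = l.re * ‖(v : EuclideanSpace ℂ (Fin k))‖ ^ 2 := by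
      rw [← Complex.ofReal_pow, Complex.re_mul_ofReal]
    have hre' : l.re * ‖(v : EuclideanSpace ℂ (Fin k))‖ ^ 2 = 0 := by
      rw [← e]
      simpa using hre
    nlinarith
  have hle := hcIndex_le ((kalmanSum_posDef_iff hS N).2 hbot)
  exact ⟨(hcIndex B).toNat, (ENat.natCast_toNat (ne_top_of_le_ne_top (ENat.natCast_ne_top N) hle)).symm⟩

end HypocoercivityIndex

/-! ### Existence of a staircase form -/

section Existence

variable {n : ℕ}

lemma inner_toEuclideanCLM_right (X : Matrix (Fin n) (Fin n) ℂ) (x y : EuclideanSpace ℂ (Fin n)) :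
    inner ℂ x (toEuclideanCLM (𝕜 := ℂ) X y) = inner ℂ (toEuclideanCLM (𝕜 := ℂ) Xᴴ x) y := by
  rw [← star_eq_conjTranspose, map_star, ContinuousLinearMap.star_eq_adjoint,
    ContinuousLinearMap.adjoint_inner_left]

lemma inner_toEuclideanCLM_self (X : Matrix (Fin n) (Fin n) ℂ) (x : EuclideanSpace ℂ (Fin n)) :
    inner ℂ x (toEuclideanCLM (𝕜 := ℂ) X x) = star x.ofLp ⬝ᵥ X *ᵥ x.ofLp := by
  rw [EuclideanSpace.inner_eq_star_dotProduct, ofLp_toEuclideanCLM, dotProduct_comm]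

lemma toEuclideanCLM_eq_zero_of_inner {X : Matrix (Fin n) (Fin n) ℂ} (hX : X.PosSemidef)
    {x : EuclideanSpace ℂ (Fin n)} (h : inner ℂ x (toEuclideanCLM (𝕜 := ℂ) X x) = 0) :
    toEuclideanCLM (𝕜 := ℂ) X x = 0 := by
  rw [inner_toEuclideanCLM_self, hX.dotProduct_mulVec_zero_iff] at h
  rwa [← WithLp.ofLp_eq_zero (p := 2), ofLp_toEuclideanCLM]

/-- The matrix whose rows are the conjugates of the vectors of a family. -/
noncomputable def rowMatrix {ι : Type} (v : ι → EuclideanSpace ℂ (Fin n)) : Matrix ι (Fin n) ℂ :=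
  Matrix.of fun p q => star ((v p).ofLp q)

lemma rowMatrix_mul_mul {ι : Type} (v : ι → EuclideanSpace ℂ (Fin n))
    (X : Matrix (Fin n) (Fin n) ℂ) (p q : ι) :
    (rowMatrix v * X * (rowMatrix v)ᴴ) p q
      = inner ℂ (v p) (toEuclideanCLM (𝕜 := ℂ) X (v q)) := by
  rw [EuclideanSpace.inner_eq_star_dotProduct, ofLp_toEuclideanCLM, dotProduct_comm,
    Matrix.mul_assoc, Matrix.mul_apply']
  congr 1
  ext k
  rw [Matrix.mul_apply', mulVec]
  congr 1
  ext l
  simp [rowMatrix]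

lemma rowMatrix_mul_conjTranspose {ι : Type} [DecidableEq ι]
    {v : ι → EuclideanSpace ℂ (Fin n)} (hv : Orthonormal ℂ v) :
    rowMatrix v * (rowMatrix v)ᴴ = 1 := by
  ext p q
  have h := rowMatrix_mul_mul v 1 p q
  rw [Matrix.mul_one, map_one, one_apply_eq_self] at h
  rw [h, Matrix.one_apply]
  exact orthonormal_iff_ite.1 hv p q

lemma inner_sum_smul {ι : Type} [Fintype ι] (v : ι → EuclideanSpace ℂ (Fin n)) (c : ι → ℂ)
    (w : EuclideanSpace ℂ (Fin n)) :
    inner ℂ (∑ i, c i • v i) w = star c ⬝ᵥ fun i => inner ℂ (v i) w := by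
  simp [dotProduct, mul_comm]

lemma submatrix_rowMatrix_mulVec {ι κ κ' : Type} [Fintype κ]
    (v : ι → EuclideanSpace ℂ (Fin n)) (X : Matrix (Fin n) (Fin n) ℂ) (f : κ' → ι) (g : κ → ι)
    (c : κ → ℂ) : (rowMatrix v * X * (rowMatrix v)ᴴ).submatrix f g *ᵥ c
      = fun i => inner ℂ (v (f i)) (toEuclideanCLM (𝕜 := ℂ) X (∑ j, c j • v (g j))) := by
  ext i
  simp [mulVec, dotProduct, rowMatrix_mul_mul, mul_comm]

lemma isUnit_of_mulVec_eq_zero {κ : Type} [Fintype κ] [DecidableEq κ] {M : Matrix κ κ ℂ}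
    (h : ∀ c, M *ᵥ c = 0 → c = 0) : IsUnit M := by
  rw [Matrix.isUnit_iff_isUnit_det, isUnit_iff_ne_zero]
  intro h0
  obtain ⟨c, hc, h1⟩ := exists_mulVec_eq_zero_iff.2 h0
  exact hc (h c h1)

lemma eq_zero_of_sum_smul_eq_zero {ι κ : Type} [Fintype κ] {v : ι → EuclideanSpace ℂ (Fin n)}
    (hv : Orthonormal ℂ v) {g : κ → ι} (hg : Function.Injective g) {c : κ → ℂ}
    (h : ∑ j, c j • v (g j) = 0) : c = 0 :=
  funext (Fintype.linearIndependent_iff.1 (hv.comp g hg).linearIndependent c h)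

lemma inner_eq_zero_of_basis {κ : Type} [Fintype κ] {U : Submodule ℂ (EuclideanSpace ℂ (Fin n))}
    (b : OrthonormalBasis κ ℂ U) {w : EuclideanSpace ℂ (Fin n)}
    (h : ∀ i, inner ℂ (b i : EuclideanSpace ℂ (Fin n)) w = 0) {u : EuclideanSpace ℂ (Fin n)}
    (hu : u ∈ U) : inner ℂ u w = 0 := by
  have : (((∑ i, b.repr ⟨u, hu⟩ i • b i : U)) : EuclideanSpace ℂ (Fin n)) = u :=
    congrArg Subtype.val (b.sum_repr ⟨u, hu⟩)
  rw [← this]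
  simp [h]

/-- Let `K = ker E`, let `N` be the set of `x ∈ K` with `R x = 0` and `J x ⊥ K`, and let `D = J N ⊆
Kᗮ`. Orthonormal bases of `D`, `Dᗮ ⊓ Kᗮ`, `Nᗮ ⊓ K` and `N`, in this order, give the first four
blocks. A vector of `N` killed by `J` lies in the kernel of both `E` and `A`, so regularity makes
`J` injective on `N`; hence `n₄ = n₁`, and the fifth block is empty. -/
theorem nonempty_staircaseForm {E A : Matrix (Fin n) (Fin n) ℂ} (hE : E.PosSemidef)
    (hA : IsSemiDissipative A) (hreg : IsRegularPencil E A) : Nonempty (StaircaseForm E A) := by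
  set e := toEuclideanCLM (𝕜 := ℂ) E with he
  set j := toEuclideanCLM (𝕜 := ℂ) (skewPart A) with hj
  set r := toEuclideanCLM (𝕜 := ℂ) (dissPart A) with hr
  have ha : toEuclideanCLM (𝕜 := ℂ) A = j - r := by
    rw [hj, hr, ← map_sub, skewPart_sub_dissPart]
  have e_symm : ∀ x y, inner ℂ x (e y) = inner ℂ (e x) y := fun x y => by
    rw [he, inner_toEuclideanCLM_right, hE.isHermitian.eq]
  have r_symm : ∀ x y, inner ℂ x (r y) = inner ℂ (r x) y := fun x y => by
    rw [hr, inner_toEuclideanCLM_right, dissPart_conjTranspose]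
  have j_symm : ∀ x y, inner ℂ x (j y) = -inner ℂ (j x) y := fun x y => by
    rw [hj, inner_toEuclideanCLM_right, skewPart_conjTranspose, map_neg, _root_.neg_apply,
      inner_neg_left]
  let K : Submodule ℂ (EuclideanSpace ℂ (Fin n)) := LinearMap.ker e.toLinearMap
  let N : Submodule ℂ (EuclideanSpace ℂ (Fin n)) :=
    K ⊓ (LinearMap.ker r.toLinearMap ⊓ Kᗮ.comap j.toLinearMap)
  have hNK : N ≤ K := inf_le_left
  have hNr : ∀ x ∈ N, r x = 0 := fun x hx => hx.2.1
  have hNj : ∀ x ∈ N, j x ∈ Kᗮ := fun x hx => hx.2.2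
  let D : Submodule ℂ (EuclideanSpace ℂ (Fin n)) := N.map j.toLinearMap
  have hDK : D ≤ Kᗮ := by
    rintro _ ⟨x, hx, rfl⟩
    exact hNj x hx
  have hinj : ∀ x ∈ N, j x = 0 → x = 0 := fun x hx hjx => by
    obtain ⟨l, hl⟩ := hreg
    by_contra hne
    refine hl (exists_mulVec_eq_zero_iff.1 ⟨x.ofLp, by rwa [Ne, WithLp.ofLp_eq_zero], ?_⟩)
    have h1 : E *ᵥ x.ofLp = 0 := by
      rw [← ofLp_toEuclideanCLM, WithLp.ofLp_eq_zero]
      exact hNK hx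
    have h2 : A *ᵥ x.ofLp = 0 := by
      rw [← ofLp_toEuclideanCLM, WithLp.ofLp_eq_zero, ha, _root_.sub_apply, hjx, hNr x hx, sub_zero]
    rw [sub_mulVec, smul_mulVec, h1, h2, smul_zero, sub_zero]
  have hDN : Module.finrank ℂ D = Module.finrank ℂ N := by
    refine (LinearEquiv.finrank_eq (LinearEquiv.ofBijective (j.toLinearMap.submoduleMap N)
      ⟨?_, j.toLinearMap.submoduleMap_surjective N⟩)).symm
    rw [← LinearMap.ker_eq_bot, LinearMap.ker_eq_bot']
    intro x hx
    exact Subtype.ext (hinj x x.2 (congrArg Subtype.val hx))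
  let U₂ : Submodule ℂ (EuclideanSpace ℂ (Fin n)) := Dᗮ ⊓ Kᗮ
  let U₃ : Submodule ℂ (EuclideanSpace ℂ (Fin n)) := Nᗮ ⊓ K
  have hdim₂ := Submodule.finrank_add_inf_finrank_orthogonal hDK
  have hdim₃ := Submodule.finrank_add_inf_finrank_orthogonal hNK
  have hdim := Submodule.finrank_add_finrank_orthogonal K
  rw [finrank_euclideanSpace_fin] at hdim
  let b₁ : OrthonormalBasis (Fin (Module.finrank ℂ N)) ℂ D :=
    (stdOrthonormalBasis ℂ D).reindex (finCongr hDN)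
  let b₂ := stdOrthonormalBasis ℂ U₂
  let b₃ := stdOrthonormalBasis ℂ U₃
  let b₄ := stdOrthonormalBasis ℂ N
  let v : StairIdx (Module.finrank ℂ N) (Module.finrank ℂ U₂) (Module.finrank ℂ U₃) 0 →
      EuclideanSpace ℂ (Fin n) :=
    Sum.elim (fun i => b₁ i) (Sum.elim (fun i => b₂ i) (Sum.elim (fun i => b₃ i)
      (Sum.elim (fun i => b₄ i) Fin.elim0)))
  have v₁ : ∀ i, v (in₁ i) ∈ D := fun i => (b₁ i).2
  have v₂ : ∀ i, v (in₂ i) ∈ U₂ := fun i => (b₂ i).2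
  have v₃ : ∀ i, v (in₃ i) ∈ U₃ := fun i => (b₃ i).2
  have v₄ : ∀ i, v (in₄ i) ∈ N := fun i => (b₄ i).2
  have o₁₂ : ∀ i k, inner ℂ (v (in₁ i)) (v (in₂ k)) = 0 := fun i k => (v₂ k).1 _ (v₁ i)
  have oK : ∀ {x y}, x ∈ K → y ∈ Kᗮ → inner ℂ x y = 0 := fun hx hy => hy _ hx
  have oK' : ∀ {x y}, x ∈ Kᗮ → y ∈ K → inner ℂ x y = 0 := fun hx hy => inner_eq_zero_symm.1 (oK hy hx)
  have o₄₃ : ∀ i k, inner ℂ (v (in₄ i)) (v (in₃ k)) = 0 := fun i k => (v₃ k).1 _ (v₄ i)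
  have hv : Orthonormal ℂ v := by
    have hsub : ∀ {κ : Type} [Fintype κ] [DecidableEq κ]
        {U : Submodule ℂ (EuclideanSpace ℂ (Fin n))}
        (b : OrthonormalBasis κ ℂ U) (i k : κ),
        inner ℂ (b i : EuclideanSpace ℂ (Fin n)) (b k) = if i = k then 1 else 0 :=
      fun b i k => orthonormal_iff_ite.1 b.orthonormal i k
    rw [orthonormal_iff_ite]
    rintro (i | i | i | i | i) (k | k | k | k | k)
    · exact (hsub b₁ i k).trans (if_congr (by simp) rfl rfl)
    · exact (o₁₂ i k).trans (if_neg (by simp)).symm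
    · exact (oK' (hDK (v₁ i)) (v₃ k).2).trans (if_neg (by simp)).symm
    · exact (oK' (hDK (v₁ i)) (hNK (v₄ k))).trans (if_neg (by simp)).symm
    · exact k.elim0
    · exact (inner_eq_zero_symm.1 (o₁₂ k i)).trans (if_neg (by simp)).symm
    · exact (hsub b₂ i k).trans (if_congr (by simp) rfl rfl)
    · exact (oK' (v₂ i).2 (v₃ k).2).trans (if_neg (by simp)).symm
    · exact (oK' (v₂ i).2 (hNK (v₄ k))).trans (if_neg (by simp)).symm
    · exact k.elim0
    · exact (oK (v₃ i).2 (hDK (v₁ k))).trans (if_neg (by simp)).symm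
    · exact (oK (v₃ i).2 (v₂ k).2).trans (if_neg (by simp)).symm
    · exact (hsub b₃ i k).trans (if_congr (by simp) rfl rfl)
    · exact (inner_eq_zero_symm.1 (o₄₃ k i)).trans (if_neg (by simp)).symm
    · exact k.elim0
    · exact (oK (hNK (v₄ i)) (hDK (v₁ k))).trans (if_neg (by simp)).symm
    · exact (oK (hNK (v₄ i)) (v₂ k).2).trans (if_neg (by simp)).symm
    · exact (o₄₃ i k).trans (if_neg (by simp)).symm
    · exact (hsub b₄ i k).trans (if_congr (by simp) rfl rfl)
    · exact k.elim0
    all_goals exact i.elim0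
  have hP := rowMatrix_mul_conjTranspose hv
  have hcard : Fintype.card (StairIdx (Module.finrank ℂ N) (Module.finrank ℂ U₂)
      (Module.finrank ℂ U₃) 0) = Fintype.card (Fin n) := by
    simp only [Fintype.card_sum, Fintype.card_fin]
    change _ + Module.finrank ℂ U₂ = _ at hdim₂
    change _ + Module.finrank ℂ U₃ = _ at hdim₃
    omega
  have hJ4 : ∀ i x, inner ℂ (v (in₄ i)) (j x) = -inner ℂ (j (v (in₄ i))) x := fun i x => j_symm _ x
  refine ⟨{
    n₁ := _, n₂ := _, n₃ := _, n₅ := 0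
    P := rowMatrix v
    mul_conjTranspose := hP
    conjTranspose_mul := (Matrix.mul_eq_one_comm_of_card_eq _ _ ℂ hcard).1 hP
    E_row₃ := fun i q => ?_
    E_row₄ := fun i q => ?_
    E_row₅ := fun i => i.elim0
    E_posDef := ?_
    J_block₄₂ := fun i k => ?_
    J_block₄₃ := fun i k => ?_
    J_block₄₄ := fun i k => ?_
    J_row₅ := fun i => i.elim0
    R_row₄ := fun i q => ?_
    R_row₅ := fun i => i.elim0
    isUnit_J₄₁ := ?_
    isUnit_A₃₃ := ?_ }⟩
  · have : e (v (in₃ i)) = 0 := (v₃ i).2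
    rw [rowMatrix_mul_mul, ← he, e_symm, this, inner_zero_left]
  · have : e (v (in₄ i)) = 0 := hNK (v₄ i)
    rw [rowMatrix_mul_mul, ← he, e_symm, this, inner_zero_left]
  · refine PosDef.of_dotProduct_mulVec_pos
      ((hE.mul_mul_conjTranspose_same _).submatrix _).isHermitian fun c hc => ?_
    set u := ∑ p, c p • v (Sum.elim in₁ in₂ p) with hu
    have h1 := inner_sum_smul (fun p => v (Sum.elim in₁ in₂ p)) c (e u)
    rw [submatrix_rowMatrix_mulVec, ← he, ← hu, ← h1, ← hu]
    have huK : u ∈ Kᗮ := Submodule.sum_mem _ fun p _ => Submodule.smul_mem _ _ (by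
      rcases p with p | p
      · exact hDK (v₁ p)
      · exact (v₂ p).2)
    refine lt_of_le_of_ne ?_ fun h0 => hc ?_
    · rw [he, inner_toEuclideanCLM_self]
      exact hE.dotProduct_mulVec_nonneg _
    · have hu0 : u ∈ K := toEuclideanCLM_eq_zero_of_inner hE h0.symm
      refine eq_zero_of_sum_smul_eq_zero hv (g := Sum.elim in₁ in₂) ?_
        (Submodule.disjoint_def.1 K.orthogonal_disjoint _ hu0 huK)
      rintro (p | p) (q | q) h <;> simp [in₁, in₂] at h <;> simp [h]
  · have h0 : inner ℂ (j (v (in₄ i))) (v (in₂ k)) = 0 :=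
      (v₂ k).1 _ (Submodule.mem_map_of_mem (v₄ i))
    rw [rowMatrix_mul_mul, ← hj, hJ4, h0, neg_zero]
  · rw [rowMatrix_mul_mul, ← hj, hJ4, oK' (hNj _ (v₄ i)) (v₃ k).2, neg_zero]
  · rw [rowMatrix_mul_mul, ← hj, hJ4, oK' (hNj _ (v₄ i)) (hNK (v₄ k)), neg_zero]
  · rw [rowMatrix_mul_mul, ← hr, r_symm, hNr _ (v₄ i), inner_zero_left]
  · refine isUnit_of_mulVec_eq_zero fun c hc => ?_
    rw [submatrix_rowMatrix_mulVec, ← hj] at hc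
    set u := ∑ p, c p • v (in₁ p) with hu
    have huD : u ∈ D := Submodule.sum_mem _ fun p _ => Submodule.smul_mem _ _ (v₁ p)
    refine eq_zero_of_sum_smul_eq_zero hv (g := in₁) (fun p q h => by simpa [in₁] using h) ?_
    -- Write `u = J x` with `x ∈ N`: orthogonality of `J u` to `N` gives `0 = ⟪x, J u⟫ = -‖u‖²`.
    obtain ⟨x, hx, hxu⟩ := id huD
    have h1 : inner ℂ x (j u) = 0 := inner_eq_zero_of_basis b₄ (fun i => congrFun hc i) hx
    rw [j_symm, neg_eq_zero] at h1
    have h2 : j x = u := hxu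
    rwa [h2, inner_self_eq_zero] at h1
  · refine isUnit_of_mulVec_eq_zero fun c hc => ?_
    rw [submatrix_rowMatrix_mulVec, ha] at hc
    set u := ∑ p, c p • v (in₃ p) with hu
    have hu₃ : u ∈ U₃ := Submodule.sum_mem _ fun p _ => Submodule.smul_mem _ _ (v₃ p)
    refine eq_zero_of_sum_smul_eq_zero hv (g := in₃) (fun p q h => by simpa [in₃] using h) ?_
    have h1 : ∀ w ∈ U₃, inner ℂ w ((j - r) u) = 0 := fun w hw =>
      inner_eq_zero_of_basis b₃ (fun i => congrFun hc i) hw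
    -- Testing with `u` itself, the skew part contributes nothing to the real part, so `⟪u, R u⟫ =
    -- 0` and semi-definiteness gives `R u = 0`.
    have hru : r u = 0 := by
      refine toEuclideanCLM_eq_zero_of_inner hA ?_
      have h2 := h1 u hu₃
      rw [_root_.sub_apply, inner_sub_right] at h2
      have h3 : (inner ℂ u (j u)).re = 0 := by
        have h4 := congrArg Complex.re (j_symm u u)
        rw [← inner_conj_symm (j u) u, Complex.neg_re, Complex.conj_re] at h4
        linarith
      have h5 : (inner ℂ u (r u)).re = 0 := by
        rw [← sub_eq_zero.1 h2, h3]
      refine Complex.ext h5 ?_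
      have h6 := hA.dotProduct_mulVec_nonneg u.ofLp
      rw [← inner_toEuclideanCLM_self] at h6
      exact (Complex.le_def.1 h6).2.symm
    -- Split `w ∈ K` into parts in `N` and `U₃`. The latter is covered by `h1`; for the former move
    -- `J` across, since `J N ⊆ Kᗮ` and `u ∈ K`. Then `u ∈ N ⊓ Nᗮ`.
    have hjK : j u ∈ Kᗮ := by
      intro w hw
      have hwN := N.starProjection_apply_mem w
      have hwU : w - N.starProjection w ∈ U₃ :=
        ⟨Submodule.sub_starProjection_mem_orthogonal w, sub_mem hw (hNK hwN)⟩
      have h2 := h1 _ hwU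
      rw [_root_.sub_apply, hru, sub_zero, inner_sub_left, j_symm (N.starProjection w),
        oK' (hNj _ hwN) hu₃.2, neg_zero, sub_zero] at h2
      exact h2
    have huN : u ∈ N := ⟨hu₃.2, hru, hjK⟩
    exact Submodule.disjoint_def.1 N.orthogonal_disjoint _ huN hu₃.1

end Existence

/-! ### The propagator of the DAE and its expansion -/

section Propagator

/-- Uniqueness by dissipation: the difference of two solutions solves the same equation, so its norm
is nonincreasing from the value zero. -/
lemma eq_exp_of_hasDerivWithinAt {V W : Type*} [NormedAddCommGroup V] [InnerProductSpace ℂ V]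
    [FiniteDimensional ℂ V] [NormedAddCommGroup W] [InnerProductSpace ℂ W] (B : V →L[ℂ] V)
    (C : V →L[ℂ] W) (hB : ∀ x, (inner ℂ x (B x)).re = -‖C x‖ ^ 2) {z : ℝ → V}
    (hz : ∀ t, 0 ≤ t → HasDerivWithinAt z (B (z t)) (Ici 0) t) {t : ℝ} (ht : 0 ≤ t) :
    z t = NormedSpace.exp (t • B) (z 0) := by
  set d : ℝ → V := fun s => z s - NormedSpace.exp (s • B) (z 0) with hd
  have hder : ∀ s, 0 ≤ s → HasDerivWithinAt d (B (d s)) (Ici 0) s := fun s hs => by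
    have := (hz s hs).sub (hasDerivAt_exp_smul_apply B (z 0) s).hasDerivWithinAt
    rw [← map_sub] at this
    exact this
  have hcont : ContinuousOn (fun s => ‖d s‖ ^ 2) (Ici 0) := fun s hs =>
    ((hder s hs).continuousWithinAt.norm).pow 2
  have hder' : ∀ s, 0 < s → HasDerivAt (fun s => ‖d s‖ ^ 2) (-2 * ‖C (d s)‖ ^ 2) s := fun s hs =>
    hasDerivAt_norm_sq_of_dissipative B C hB ((hder s hs.le).hasDerivAt (Ici_mem_nhds hs))
  have hanti : AntitoneOn (fun s => ‖d s‖ ^ 2) (Ici 0) := by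
    refine antitoneOn_of_deriv_nonpos (convex_Ici 0) hcont ?_ ?_
    · rw [interior_Ici]
      exact fun s hs => (hder' s hs).differentiableAt.differentiableWithinAt
    · rw [interior_Ici]
      intro s hs
      rw [(hder' s hs).deriv]
      have := sq_nonneg ‖C (d s)‖
      linarith
  have h1 : ‖d t‖ ^ 2 ≤ ‖d 0‖ ^ 2 := hanti self_mem_Ici ht ht
  have h0 : d 0 = 0 := sub_eq_zero.2 (exp_zero_smul_apply B (z 0)).symm
  rw [h0, norm_zero] at h1
  have h2 : d t = 0 := by
    rw [← norm_eq_zero]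
    nlinarith [norm_nonneg (d t)]
  exact sub_eq_zero.1 h2

lemma hasDerivWithinAt_linearMap_comp {V W : Type*} [NormedAddCommGroup V] [NormedSpace ℂ V]
    [FiniteDimensional ℂ V] [NormedAddCommGroup W] [NormedSpace ℂ W] (f : V →ₗ[ℂ] W)
    {x : ℝ → V} {x' : V} {s : Set ℝ} {t : ℝ} (h : HasDerivWithinAt x x' s t) :
    HasDerivWithinAt (fun r => f (x r)) (f x') s t :=
  (f.toContinuousLinearMap.restrictScalars ℝ).hasFDerivAt.comp_hasDerivWithinAt t h

variable {n : ℕ} {E A : Matrix (Fin n) (Fin n) ℂ}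

lemma eSeminorm_eq_norm {k : ℕ} {x : Fin n → ℂ} {z : EuclideanSpace ℂ (Fin k)}
    (h : star x ⬝ᵥ E *ᵥ x = star z.ofLp ⬝ᵥ z.ofLp) : eSeminorm E x = ‖z‖ := by
  rw [eSeminorm, h, re_star_dotProduct_self, Complex.ofReal_re, Real.sqrt_sq (norm_nonneg _)]

namespace StaircaseForm

/-- From `A T = E T B` and `Tᴴ E T = 1` follows `B = Tᴴ A T`, and congruence preserves
semi-dissipativity. -/
lemma systemMatrix_isSemiDissipative (hE : E.IsHermitian) (hA : IsSemiDissipative A)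
    (F : StaircaseForm E A) : IsSemiDissipative F.systemMatrix := by
  obtain ⟨T, h1, h2⟩ := F.exists_lift hE
  have : F.systemMatrix = Tᴴ * A * T := by
    rw [Matrix.mul_assoc, h1, ← Matrix.mul_assoc, ← Matrix.mul_assoc, h2, Matrix.one_mul]
  rw [IsSemiDissipative, this, dissPart_congr]
  exact PosSemidef.conjTranspose_mul_mul_same hA T

lemma propagatorValues_eq (hE : E.IsHermitian) (hA : IsSemiDissipative A)
    (F : StaircaseForm E A) {t : ℝ} (ht : 0 ≤ t) : propagatorValues E A t
      = {s | ∃ z : EuclideanSpace ℂ (Fin F.n₂), ‖z‖ = 1 ∧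
        s = ‖NormedSpace.exp (t • toEuclideanCLM (𝕜 := ℂ) F.systemMatrix) z‖} := by
  set b := toEuclideanCLM (𝕜 := ℂ) F.systemMatrix with hb
  obtain ⟨S, hS⟩ := exists_dissPart_factor (F.systemMatrix_isSemiDissipative hE hA)
  have hB := re_inner_of_factor hS
  rw [← hb] at hB
  obtain ⟨T, hT, hT1⟩ := F.exists_lift hE
  obtain ⟨L, Z, hLZ⟩ := F.exists_proj hE
  ext s
  constructor
  · rintro ⟨x, hx, hx1, rfl⟩
    let z : ℝ → EuclideanSpace ℂ (Fin F.n₂) := fun t => WithLp.toLp 2 (Z *ᵥ x t)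
    have hnorm : ∀ t, 0 ≤ t → eSeminorm E (x t) = ‖z t‖ := fun t ht =>
      eSeminorm_eq_norm (hLZ _ _ (hx.eq t ht)).2.2
    have hxd : ∀ t, 0 ≤ t → HasDerivWithinAt x (derivWithin x (Ici 0) t) (Ici 0) t :=
      fun t ht => ((hx.contDiffOn.differentiableOn one_ne_zero) t ht).hasDerivWithinAt
    have hz : ∀ t, 0 ≤ t → HasDerivWithinAt z (b (z t)) (Ici 0) t := fun t ht => by
      have h1 : HasDerivWithinAt (fun r => L *ᵥ x r) (L *ᵥ derivWithin x (Ici 0) t) (Ici 0) t :=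
        hasDerivWithinAt_linearMap_comp L.mulVecLin (hxd t ht)
      have h2 : HasDerivWithinAt (fun r => L *ᵥ x r) 0 (Ici 0) t :=
        (hasDerivWithinAt_const t (Ici 0) 0).congr (fun r hr => (hLZ _ _ (hx.eq r hr)).1)
          (hLZ _ _ (hx.eq t ht)).1
      -- `L x` vanishes at all times, so its derivative does too: the premise required in
      -- `exists_proj`.
      have h3 := (uniqueDiffOn_Ici (0 : ℝ) t ht).eq_deriv _ h1 h2
      have h4 := hasDerivWithinAt_linearMap_comp
        ((WithLp.linearEquiv 2 ℂ (Fin F.n₂ → ℂ)).symm.toLinearMap ∘ₗ Z.mulVecLin) (hxd t ht)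
      refine h4.congr_deriv ?_
      rw [hb, toEuclideanCLM_toLp, ← (hLZ _ _ (hx.eq t ht)).2.1 h3]
      rfl
    refine ⟨z 0, ?_, ?_⟩
    · rw [← hnorm 0 le_rfl, hx1]
    · rw [← eq_exp_of_hasDerivWithinAt b _ hB hz ht, hnorm t ht]
  · rintro ⟨z, hz, rfl⟩
    let y : ℝ → EuclideanSpace ℂ (Fin F.n₂) := fun t => NormedSpace.exp (t • b) z
    let x : ℝ → Fin n → ℂ := fun t => T *ᵥ (y t).ofLp
    have hy : ∀ t, HasDerivAt y (b (y t)) t := fun t => hasDerivAt_exp_smul_apply b z t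
    have hx : ∀ t, HasDerivAt x (T *ᵥ (b (y t)).ofLp) t := fun t => by
      rw [← hasDerivWithinAt_univ]
      exact hasDerivWithinAt_linearMap_comp
        (T.mulVecLin ∘ₗ (WithLp.linearEquiv 2 ℂ (Fin F.n₂ → ℂ)).toLinearMap)
        (hy t).hasDerivWithinAt
    have hnorm : ∀ t, eSeminorm E (x t) = ‖y t‖ := fun t => by
      refine eSeminorm_eq_norm ?_
      rw [star_mulVec, ← dotProduct_mulVec, mulVec_mulVec, mulVec_mulVec, hT1, one_mulVec]
    refine ⟨x, ⟨?_, fun t ht => ?_⟩, ?_, (hnorm t).symm⟩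
    · refine ContDiff.contDiffOn (contDiff_one_iff_deriv.2
        ⟨fun t => (hx t).differentiableAt, ?_⟩)
      rw [funext fun t => (hx t).deriv]
      have hyc : Continuous y := continuous_iff_continuousAt.2 fun t => (hy t).continuousAt
      fun_prop
    · rw [(hx t).hasDerivWithinAt.derivWithin (uniqueDiffOn_Ici 0 t ht), hb, ofLp_toEuclideanCLM,
        mulVec_mulVec, mulVec_mulVec, mulVec_mulVec, hT]
    · have hy0 : y 0 = z := exp_zero_smul_apply b z
      rw [hnorm, hy0, hz]

lemma isLUB_propagatorSeminorm (hE : E.IsHermitian) (hA : IsSemiDissipative A)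
    (F : StaircaseForm E A) (hF : 0 < F.n₂) {t : ℝ} (ht : 0 ≤ t) :
    IsLUB (propagatorValues E A t) (propagatorSeminorm E A t) := by
  obtain ⟨S, hS⟩ := exists_dissPart_factor (F.systemMatrix_isSemiDissipative hE hA)
  rw [propagatorSeminorm, F.propagatorValues_eq hE hA ht]
  refine isLUB_csSup ⟨_, EuclideanSpace.single ⟨0, hF⟩ 1, by simp, rfl⟩ ⟨1, ?_⟩
  rintro _ ⟨z, hz, rfl⟩
  rw [← hz]
  exact norm_exp_apply_le _ _ (re_inner_of_factor hS) ht z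

/-- The expansion of the propagator seminorm in terms of the HC-index of any staircase form. -/
lemma propagatorSeminorm_expansion (hE : E.IsHermitian) (hA : IsSemiDissipative A)
    (F : StaircaseForm E A) (hF : 0 < F.n₂) {m : ℕ} (hm : hcIndex F.systemMatrix = m) :
    ∃ c : ℝ, 0 < c ∧ (fun t : ℝ => propagatorSeminorm E A t - (1 - c * t ^ (2 * m + 1)))
      =O[𝓝[>] 0] (fun t : ℝ => t ^ (2 * m + 1 + 1)) := by
  obtain ⟨S, hS⟩ := exists_dissPart_factor (F.systemMatrix_isSemiDissipative hE hA)
  obtain ⟨h1, h2⟩ := obsKer_of_hcIndex_eq hS hF hm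
  refine exists_isBigO_of_isLUB _ _ (re_inner_of_factor hS) h1 h2 fun t ht => ?_
  rw [← F.propagatorValues_eq hE hA ht.le]
  exact F.isLUB_propagatorSeminorm hE hA hF ht.le

/-- If `B z = l z` then `A T z = l E T z`, and `T z ≠ 0` because `Tᴴ E T = 1`; so eigenvalues of the
system matrix are finite eigenvalues of the pencil. -/
lemma exists_hcIndex_systemMatrix_eq (hE : E.IsHermitian) (hA : IsSemiDissipative A)
    (hev : ∀ l : ℂ, IsFiniteEigenvalue E A l → l.re < 0) (F : StaircaseForm E A) :
    ∃ m : ℕ, hcIndex F.systemMatrix = m := by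
  obtain ⟨T, hT, hT1⟩ := F.exists_lift hE
  refine exists_hcIndex_eq (F.systemMatrix_isSemiDissipative hE hA) fun l z hz hlz => hev l ?_
  refine exists_mulVec_eq_zero_iff.1 ⟨T *ᵥ z, fun h0 => hz ?_, ?_⟩
  · rw [← one_mulVec z, ← hT1, ← mulVec_mulVec, h0, mulVec_zero]
  · rw [sub_mulVec, mulVec_mulVec z A, hT, ← mulVec_mulVec, hlz, mulVec_smul, smul_mulVec,
      mulVec_mulVec, sub_self]

end StaircaseForm

end Propagator

end HCDAE

/-! ### Main theorem -/

theorem mainTheorem2 {n : ℕ} (E A : Matrix (Fin n) (Fin n) ℂ)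
    (hE : E.PosSemidef) (hA : HCDAE.IsSemiDissipative A)
    (hEA : HCDAE.IsNegativeHypocoercive E A)
    (hdyn : HCDAE.HasNontrivialDynamics E A) :
    (∀ t : ℝ, 0 ≤ t →
      IsLUB (HCDAE.propagatorValues E A t) (HCDAE.propagatorSeminorm E A t)) ∧
    (∃ m : ℕ, HCDAE.HasHCIndex E A m) ∧
    ∀ m : ℕ, HCDAE.HasHCIndex E A m ↔
      ∃ c : ℝ, 0 < c ∧
        (fun t : ℝ => HCDAE.propagatorSeminorm E A t - (1 - c * t ^ (2 * m + 1)))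
          =O[𝓝[>] 0] (fun t : ℝ => t ^ (2 * m + 1 + 1)) := by
  have hH := hE.isHermitian
  have hne := HCDAE.nonempty_staircaseForm hE hA hEA.regular
  -- Every staircase form yields an expansion of the same function, so uniqueness of the exponent
  -- fixes all their HC-indices at once. Applied to the expansion from one form, this proves
  -- independence of the choice; applied to a given expansion, the converse implication.
  have hindex : ∀ {m : ℕ} {c : ℝ}, 0 < c →
      (fun t : ℝ => HCDAE.propagatorSeminorm E A t - (1 - c * t ^ (2 * m + 1)))
        =O[𝓝[>] 0] (fun t : ℝ => t ^ (2 * m + 1 + 1)) → HCDAE.HasHCIndex E A m := by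
    refine fun {m c} hc h => ⟨hne, fun F => ?_⟩
    obtain ⟨k, hk⟩ := F.exists_hcIndex_systemMatrix_eq hH hA hEA.re_neg
    obtain ⟨d, hd, h'⟩ := F.propagatorSeminorm_expansion hH hA (hdyn F) hk
    have := HCDAE.exponent_unique hc hd h h'
    rw [hk]
    congr 1
    omega
  obtain ⟨F⟩ := id hne
  obtain ⟨k, hk⟩ := F.exists_hcIndex_systemMatrix_eq hH hA hEA.re_neg
  obtain ⟨d, hd, h'⟩ := F.propagatorSeminorm_expansion hH hA (hdyn F) hk
  exact ⟨fun t ht => F.isLUB_propagatorSeminorm hH hA (hdyn F) ht, ⟨k, hindex hd h'⟩,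
    fun m => ⟨fun h => F.propagatorSeminorm_expansion hH hA (hdyn F) (h.2 F),
      fun ⟨c, hc, h⟩ => hindex hc h⟩⟩
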